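/- For a set $P$ of points in the plane, the visibility graph of $P$ has vertex set $P$, and two distinct points of $P$ are adjacent if and only if the open segment between them contains no other point of $P$. A point visibility graph is a graph $G$ isomorphic to the visibility graph of a finite set $P\subset\mathbb{R}^2$; an assignment of the vertices of $G$ to distinct points of the plane that makes $G$ the visibility graph of these points is a realization of $G$, and it is a grid realization if all the points lie in $\mathbb{Z}^2$. Theorem. There are constants $c,C>0$ and $n_0\in\mathbb{N}$ such that for every $n\ge n_0$ there is a point visibility graph $G$ on $n$ vertices with the following two properties. 1. In every grid realization of $G$ some point has a coordinate of absolute value at least $2^{2^{c\sqrt[3]{n}}}$. 2. $G$ has a grid realization in which all coordinates have absolute value at most $2^{2^{C\sqrt[3]{n}}}$. In other words, the size of the coordinates required by the grid realizations of $G$ is $2^{2^{\Theta(\sqrt[3]{n})}}$. -/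

import Mathlib

/-- The visibility graph of a family of points in the plane: two distinct vertices are adjacent
iff the open segment between their points contains no point of the family. (When `p` is injective
the end points are not in the open segment, so "no point" means "no other point".) -/
def visibilityGraph {V : Type*} (p : V → ℝ × ℝ) : SimpleGraph V where
  Adj u v := u ≠ v ∧ ∀ w, p w ∉ openSegment ℝ (p u) (p v)
  symm := ⟨fun u v h => ⟨h.1.symm, fun w => by rw [openSegment_symm]; exact h.2 w⟩⟩
  loopless := ⟨fun _ h => h.1 rfl⟩

/-- `p` realizes `G`: the vertices of `G` are placed at pairwise distinct points of the plane,
and `G` is the visibility graph of these points. -/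
structure IsRealization {V : Type*} (G : SimpleGraph V) (p : V → ℝ × ℝ) : Prop where
  injective : Function.Injective p
  visibilityGraph_eq : visibilityGraph p = G

/-- `G` is a point visibility graph. -/
def IsPointVisibilityGraph {V : Type*} (G : SimpleGraph V) : Prop :=
  ∃ p : V → ℝ × ℝ, IsRealization G p

/-- A realization of `G` all of whose points lie on the integer grid. -/
def IsGridRealization {V : Type*} (G : SimpleGraph V) (q : V → ℤ × ℤ) : Prop :=
  IsRealization G (fun v => (((q v).1 : ℝ), ((q v).2 : ℝ)))

/-! Two of the vertices, q and q', span a base line. Adjacency alone (`IsFanCorner`) forces all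
other points strictly to one side of it, so in every realization the base line can be projected to
infinity: lines through q become vertical, lines through q' become horizontal, and betweenness among
the other points survives. The neighbours of q are then the lowest points of the columns, those of
q' the leftmost points of the rows. Paths along the bottom and the left side fix the order of
columns and rows, and a pigeonhole argument (`IsBottom.eq_of_adj`) recovers the column and the row
of every cell outside the first two rows and columns.

In this rigid grid a missing edge forces a blocker on one of the intermediate columns and rows, that
is, an equation between products of gaps. Four missing edges and one edge per step turn the ratio t
of consecutive column gaps into t + t² (`ratio_recursion`), so k ≥ 1 steps produce a ratio of at
least 2^2^(k-1). For a grid realization with coordinates bounded by B the abscissas after projection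
are quotients of integers of size O(B²), so this ratio is at most 1024 B^6 (`IsGridGraph.ratio_le`),
and B is doubly exponential in k.

Conversely, explicit integer gaps of size 2^O(2^k) satisfy all these equations, with the first row
and column so far away that they create no unwanted collinearity (`exists_isGridCoordinates`,
`IsGridCoordinates.isGridGraph`). Undoing the projection and clearing denominators costs an n-th
power, which keeps the size at 2^2^O(k). The full rows need only O(k²) points, which fit for k =
⌊n^(1/3)⌋; rows with two cells use up the rest of the n vertices. -/

/-! ### Betweenness and affine changes of coordinates -/

/-- The point `w` lies strictly between `u` and `v`, for points with coordinates `x` and `y`. -/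
def Blocks {V : Type*} (x y : V → ℝ) (u w v : V) : Prop :=
  ∃ t : ℝ, 0 < t ∧ t < 1 ∧ x w = x u + t * (x v - x u) ∧ y w = y u + t * (y v - y u)

theorem Blocks.swap {V : Type*} {x y : V → ℝ} {u w v : V} (h : Blocks x y u w v) :
    Blocks y x u w v := by
  obtain ⟨t, h0, h1, hx, hy⟩ := h
  exact ⟨t, h0, h1, hy, hx⟩

theorem Blocks.reverse {V : Type*} {x y : V → ℝ} {u w v : V} (h : Blocks x y u w v) :
    Blocks x y v w u := by
  obtain ⟨t, h0, h1, hx, hy⟩ := h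
  exact ⟨1 - t, by linarith, by linarith, by rw [hx]; ring, by rw [hy]; ring⟩

theorem mem_openSegment_iff_blocks {V : Type*} (p : V → ℝ × ℝ) (u w v : V) :
    p w ∈ openSegment ℝ (p u) (p v) ↔
      Blocks (fun z => (p z).1) (fun z => (p z).2) u w v := by
  rw [openSegment_eq_image]
  constructor
  · rintro ⟨t, ⟨h0, h1⟩, h⟩
    refine ⟨t, h0, h1, ?_, ?_⟩
    · have := congrArg Prod.fst h
      simp at this
      simp only [← this]; ring
    · have := congrArg Prod.snd h
      simp at this
      simp only [← this]; ring
  · rintro ⟨t, h0, h1, hx, hy⟩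
    refine ⟨t, ⟨h0, h1⟩, Prod.ext ?_ ?_⟩
    · simp only [Prod.fst_add, Prod.smul_fst, smul_eq_mul, hx]; ring
    · simp only [Prod.snd_add, Prod.smul_snd, smul_eq_mul, hy]; ring

/-- `G` is the visibility graph of the distinct points with coordinates `x` and `y`. -/
structure IsDrawing {V : Type*} (G : SimpleGraph V) (x y : V → ℝ) : Prop where
  injective : ∀ u v, x u = x v → y u = y v → u = v
  adj_iff : ∀ u v, G.Adj u v ↔ u ≠ v ∧ ∀ w, ¬ Blocks x y u w v

theorem isRealization_iff_isDrawing {V : Type*} {G : SimpleGraph V} {p : V → ℝ × ℝ} :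
    IsRealization G p ↔ IsDrawing G (fun v => (p v).1) (fun v => (p v).2) := by
  constructor
  · rintro ⟨hi, rfl⟩
    refine ⟨fun u v h1 h2 => hi (Prod.ext h1 h2), fun u v => ?_⟩
    simp [visibilityGraph, mem_openSegment_iff_blocks]
  · rintro ⟨hi, ha⟩
    refine ⟨fun u v h => hi u v (by simp [h]) (by simp [h]), ?_⟩
    ext u v
    rw [ha]
    simp [visibilityGraph, mem_openSegment_iff_blocks]

theorem Blocks.affine {V : Type*} {x y f g : V → ℝ} (a b c a' b' c' : ℝ)
    (hf : ∀ v, f v = a * x v + b * y v + c) (hg : ∀ v, g v = a' * x v + b' * y v + c')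
    {u w v : V} (h : Blocks x y u w v) : Blocks f g u w v := by
  obtain ⟨t, h0, h1, hx, hy⟩ := h
  refine ⟨t, h0, h1, ?_, ?_⟩
  · simp only [hf, hx, hy]; ring
  · simp only [hg, hx, hy]; ring

theorem IsDrawing.affine {V : Type*} {G : SimpleGraph V} {x y f g : V → ℝ}
    (h : IsDrawing G x y) (a b c a' b' c' : ℝ) (hdet : a * b' - b * a' ≠ 0)
    (hf : ∀ v, f v = a * x v + b * y v + c) (hg : ∀ v, g v = a' * x v + b' * y v + c') :
    IsDrawing G f g := by
  set e := a * b' - b * a' with he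
  have hx : ∀ v, x v = b' / e * f v + (-b / e) * g v + (b * c' - b' * c) / e := by
    intro v; rw [hf, hg]; field_simp; rw [he]; ring
  have hy : ∀ v, y v = (-a' / e) * f v + a / e * g v + (a' * c - a * c') / e := by
    intro v; rw [hf, hg]; field_simp; rw [he]; ring
  refine ⟨fun u v h1 h2 => h.injective u v ?_ ?_, fun u v => ?_⟩
  · rw [hx, hx, h1, h2]
  · rw [hy, hy, h1, h2]
  · rw [h.adj_iff]
    refine and_congr_right fun _ => forall_congr' fun w => not_congr ⟨?_, ?_⟩
    · exact Blocks.affine _ _ _ _ _ _ hf hg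
    · exact Blocks.affine _ _ _ _ _ _ hx hy

/-! ### Forcing all points to one side of a base line -/

/-- If some point lies above the line through `q` and `q'`, then there is one that sees both `q`
and `q'` and comes first in the angular order around `q`. -/
theorem IsDrawing.exists_common_neighbor {V : Type*} [Finite V] {G : SimpleGraph V}
    {f l : V → ℝ} (h : IsDrawing G f l) {q q' : V} {D : ℝ} (hD : 0 < D)
    (hfq : f q = 0) (hlq : l q = 0) (hfq' : f q' = D) (hlq' : l q' = 0) (hne : ∃ v, 0 < l v) :
    ∃ w, 0 < l w ∧ G.Adj q w ∧ G.Adj q' w ∧ ∀ v, 0 < l v → f v / l v ≤ f w / l w := by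
  -- The quotient `f v / l v` is the cotangent of the angle at `q`; the point sought is the nearest
  -- one on the extreme ray.
  obtain ⟨a, ha, hmax⟩ := Set.exists_max_image {v | 0 < l v} (fun v => f v / l v)
    (Set.toFinite _) hne
  obtain ⟨w, ⟨hw, hwa⟩, hmin⟩ := Set.exists_min_image
    {v | 0 < l v ∧ f v / l v = f a / l a} l (Set.toFinite _) ⟨a, ha, rfl⟩
  simp only [Set.mem_ofPred_eq] at *
  refine ⟨w, hw, (h.adj_iff _ _).2 ⟨?_, ?_⟩, (h.adj_iff _ _).2 ⟨?_, ?_⟩, fun v hv => ?_⟩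
  · rintro rfl; linarith
  · rintro z ⟨t, h0, h1, hx, hy⟩
    rw [hfq] at hx; rw [hlq] at hy
    have hlz : l z = t * l w := by rw [hy]; ring
    have hfz : f z = t * f w := by rw [hx]; ring
    have := hmin z ⟨by rw [hlz]; positivity, by rw [hlz, hfz, ← hwa]; field_simp⟩
    rw [hlz] at this
    nlinarith
  · rintro rfl; linarith
  -- A blocker between `q'` and `w` would have a larger cotangent at `q` than `w`.
  · rintro z ⟨t, h0, h1, hx, hy⟩
    rw [hfq'] at hx; rw [hlq'] at hy
    have hlz : l z = t * l w := by rw [hy]; ring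
    have hfz : f z = (1 - t) * D + t * f w := by rw [hx]; ring
    have hz : 0 < l z := by rw [hlz]; positivity
    have := hmax z hz
    rw [← hwa, div_le_div_iff₀ hz hw, hlz, hfz] at this
    have : 0 < (1 - t) * D * l w := by
      have : 0 < 1 - t := by linarith
      positivity
    nlinarith
  · rw [hwa]; exact hmax v hv

/-- No point lies on the line through `q` and `q'` beyond `q`. -/
theorem IsDrawing.not_beyond {V : Type*} [Finite V] {G : SimpleGraph V}
    {f l : V → ℝ} (h : IsDrawing G f l) {q q' o r₁ r₂ : V} {D : ℝ} (hD : 0 < D)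
    (hfq : f q = 0) (hlq : l q = 0) (hfq' : f q' = D) (hlq' : l q' = 0) (ho : 0 < l o)
    (hl : ∀ v, 0 ≤ l v) (hmax : ∀ v, 0 < l v → f v / l v ≤ f o / l o)
    (hmax' : ∀ v, 0 < l v → (D - f v) / l v ≤ (D - f o) / l o)
    (hr₁ : ∀ u, G.Adj q u → G.Adj o u → u = q' ∨ u = r₁) (hqo : G.Adj q o) (hqq : G.Adj q q')
    (hr₂ : G.Adj q r₂) (ho₂ : r₂ ≠ o) (h₁₂ : r₂ ≠ r₁) (hq₂ : r₂ ≠ q') (w : V) (hw : l w = 0) :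
    0 ≤ f w := by
  by_contra! hfw
  -- Of the points beyond `q`, the nearest one is visible from `q`. It is also visible from `o`,
  -- since a blocker would come before `o` in the angular order around `q'`. Hence it is `r₁`.
  obtain ⟨a, ⟨hla, hfa⟩, hamax⟩ := Set.exists_max_image {v | l v = 0 ∧ f v < 0} f
    (Set.toFinite _) ⟨w, hw, hfw⟩
  simp only [Set.mem_ofPred_eq] at *
  have hqa : G.Adj q a := by
    refine (h.adj_iff _ _).2 ⟨by rintro rfl; linarith, ?_⟩
    rintro z ⟨t, h0, h1, hx, hy⟩
    rw [hfq] at hx; rw [hlq, hla] at hy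
    have := hamax z ⟨by rw [hy]; ring, by rw [hx]; nlinarith⟩
    rw [hx] at this
    nlinarith
  have hoa : G.Adj o a := by
    refine (h.adj_iff _ _).2 ⟨by rintro rfl; linarith, ?_⟩
    rintro z ⟨t, h0, h1, hx, hy⟩
    rw [hla] at hy
    have h1t : 0 < 1 - t := by linarith
    have hlz : l z = (1 - t) * l o := by rw [hy]; ring
    have hz : 0 < l z := by rw [hlz]; positivity
    have := hmax' z hz
    rw [div_le_div_iff₀ hz ho, hlz, hx] at this
    have : 0 < t * (D - f a) * l o := by
      have : 0 < D - f a := by linarith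
      positivity
    nlinarith
  have ha₁ : a = r₁ := by
    rcases hr₁ a hqa hoa with rfl | rfl
    · linarith
    · rfl
  -- Otherwise the nearest point on the second ray around `q` is another common neighbour of `q` and
  -- `o`, although `q'` and `r₁` both lie on the base line.
  have hray : ∀ v, 0 < l v → f v / l v = f o / l o := by
    by_contra! hne
    obtain ⟨v, hv, hvne⟩ := hne
    obtain ⟨b, ⟨hb, hbo⟩, hbmax⟩ := Set.exists_max_image
      {v | 0 < l v ∧ f v / l v < f o / l o} (fun v => f v / l v)
      (Set.toFinite _) ⟨v, hv, lt_of_le_of_ne (hmax v hv) hvne⟩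
    obtain ⟨c, ⟨hc, hcb⟩, hcmin⟩ := Set.exists_min_image
      {v | 0 < l v ∧ f v / l v = f b / l b} l (Set.toFinite _) ⟨b, hb, rfl⟩
    simp only [Set.mem_ofPred_eq] at *
    rw [← hcb] at hbo
    have hqc : G.Adj q c := by
      refine (h.adj_iff _ _).2 ⟨by rintro rfl; linarith, ?_⟩
      rintro z ⟨t, h0, h1, hx, hy⟩
      rw [hfq] at hx; rw [hlq] at hy
      have hlz : l z = t * l c := by rw [hy]; ring
      have hfz : f z = t * f c := by rw [hx]; ring
      have := hcmin z ⟨by rw [hlz]; positivity, by rw [hlz, hfz, ← hcb]; field_simp⟩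
      rw [hlz] at this
      nlinarith
    have hoc : G.Adj o c := by
      refine (h.adj_iff _ _).2 ⟨by rintro rfl; linarith, ?_⟩
      rintro z ⟨t, h0, h1, hx, hy⟩
      have h1t : 0 < 1 - t := by linarith
      have hlz : l z = (1 - t) * l o + t * l c := by rw [hy]; ring
      have hfz : f z = (1 - t) * f o + t * f c := by rw [hx]; ring
      have hz : 0 < l z := by rw [hlz]; positivity
      rw [div_lt_div_iff₀ hc ho] at hbo
      have h1 : f z / l z < f o / l o := by
        rw [div_lt_div_iff₀ hz ho, hlz, hfz]
        nlinarith
      have h2 := hbmax z ⟨hz, h1⟩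
      rw [← hcb, div_le_div_iff₀ hz hc, hlz, hfz] at h2
      nlinarith
    rcases hr₁ c hqc hoc with rfl | rfl
    · linarith
    · rw [← ha₁] at hc; linarith
  -- Now all points lie on the base line or on the ray from `q` through `o`, so `q` sees only `o`,
  -- `q'` and `r₁`, which leaves no place for `r₂`.
  rcases (hl r₂).lt_or_eq with h2 | h2
  · have hr := hray r₂ h2
    rw [div_eq_div_iff h2.ne' ho.ne'] at hr
    rcases lt_trichotomy (l r₂) (l o) with hlt | heq | hgt
    · refine ((h.adj_iff _ _).1 hqo).2 r₂ ⟨l r₂ / l o, by positivity, by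
        rw [div_lt_one ho]; exact hlt, ?_, ?_⟩
      · rw [hfq]; field_simp; linarith
      · rw [hlq]; field_simp; ring
    · exact ho₂ (h.injective _ _ (by rw [heq] at hr; exact mul_right_cancel₀ ho.ne' hr) heq)
    · refine ((h.adj_iff _ _).1 hr₂).2 o ⟨l o / l r₂, by positivity, by
        rw [div_lt_one h2]; exact hgt, ?_, ?_⟩
      · rw [hfq]; field_simp; linarith
      · rw [hlq]; field_simp; ring
  · have hadj := ((h.adj_iff _ _).1 hr₂)
    rcases lt_trichotomy (f r₂) 0 with hlt | heq | hgt
    · have hle := hamax r₂ ⟨h2.symm, hlt⟩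
      have hlt' : f r₂ < f a := lt_of_le_of_ne hle fun he =>
        h₁₂ (ha₁ ▸ h.injective _ _ he (by rw [hla, ← h2]))
      refine hadj.2 a ⟨f a / f r₂, div_pos_of_neg_of_neg hfa hlt, ?_, ?_, ?_⟩
      · rw [div_lt_one_of_neg hlt]; exact hlt'
      · rw [hfq]; have := hlt.ne; field_simp; ring
      · rw [hlq, hla, ← h2]; ring
    · exact hadj.1 (h.injective _ _ (by rw [heq, hfq]) (by rw [hlq, ← h2]))
    · rcases lt_trichotomy (f r₂) D with h3 | h3 | h3
      · refine ((h.adj_iff _ _).1 hqq).2 r₂ ⟨f r₂ / D, by positivity, ?_, ?_, ?_⟩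
        · rw [div_lt_one hD]; exact h3
        · rw [hfq, hfq']; field_simp; ring
        · rw [hlq, hlq', ← h2]; ring
      · exact hq₂ (h.injective _ _ (by rw [h3, hfq']) (by rw [hlq', ← h2]))
      · refine hadj.2 q' ⟨D / f r₂, by positivity, ?_, ?_, ?_⟩
        · rw [div_lt_one hgt]; exact h3
        · rw [hfq, hfq']; field_simp; ring
        · rw [hlq, hlq', ← h2]; ring

/-- Graph-theoretic conditions which force, in every drawing, all vertices other than `q` and `q'`
to lie on one side of the line through `q` and `q'`, with `o` first in the angular order around
both `q` and `q'`. -/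
structure IsFanCorner {V : Type*} (G : SimpleGraph V) (q q' o : V) : Prop where
  adj : G.Adj q q'
  adj_left : G.Adj q o
  adj_right : G.Adj q' o
  unique : ∀ u, G.Adj q u → G.Adj q' u → u = o
  left : ∃ r₁ r₂, (∀ u, G.Adj q u → G.Adj o u → u = q' ∨ u = r₁) ∧
    G.Adj q r₂ ∧ r₂ ≠ o ∧ r₂ ≠ r₁ ∧ r₂ ≠ q'
  right : ∃ r₁ r₂, (∀ u, G.Adj q' u → G.Adj o u → u = q ∨ u = r₁) ∧
    G.Adj q' r₂ ∧ r₂ ≠ o ∧ r₂ ≠ r₁ ∧ r₂ ≠ q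

/-- Of three collinear points the middle one blocks the other two, so pairwise adjacent points form
a triangle. -/
theorem IsFanCorner.ne_zero {V : Type*} {G : SimpleGraph V} {f l : V → ℝ}
    {q q' o : V} (hG : IsFanCorner G q q' o) (h : IsDrawing G f l) {D : ℝ} (hD : 0 < D)
    (hfq : f q = 0) (hlq : l q = 0) (hfq' : f q' = D) (hlq' : l q' = 0) : l o ≠ 0 := by
  intro ho
  have h1 := (h.adj_iff _ _).1 hG.adj
  have h2 := (h.adj_iff _ _).1 hG.adj_left
  have h3 := (h.adj_iff _ _).1 hG.adj_right
  rcases lt_trichotomy (f o) 0 with hlt | heq | hgt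
  · refine h3.2 q ⟨D / (D - f o), div_pos hD (by linarith), ?_, ?_, ?_⟩
    · rw [div_lt_one (by linarith)]; linarith
    · have : D - f o ≠ 0 := by linarith
      rw [hfq, hfq']; field_simp; ring
    · rw [hlq, hlq', ho]; ring
  · exact h2.1 (h.injective _ _ (by rw [hfq, heq]) (by rw [hlq, ho]))
  · rcases lt_trichotomy (f o) D with hlt | heq | hgt'
    · refine h1.2 o ⟨f o / D, by positivity, ?_, ?_, ?_⟩
      · rw [div_lt_one hD]; linarith
      · rw [hfq, hfq']; field_simp; ring
      · rw [hlq, hlq', ho]; ring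
    · exact h3.1 (h.injective _ _ (by rw [hfq', heq]) (by rw [hlq', ho]))
    · refine h2.2 q' ⟨D / f o, by positivity, ?_, ?_, ?_⟩
      · rw [div_lt_one hgt]; linarith
      · rw [hfq, hfq']; field_simp; ring
      · rw [hlq, hlq', ho]; ring

/-- Each side of the base line that contains a point contains a common neighbour of `q` and `q'`; as
`o` is the only one, the other side is empty. Points on the base line are excluded beyond either end
by `not_beyond` and between the ends by adjacency. -/
theorem IsFanCorner.pos_and_max {V : Type*} [Finite V] {G : SimpleGraph V} {f l : V → ℝ}
    {q q' o : V} (hG : IsFanCorner G q q' o) (h : IsDrawing G f l) {D : ℝ} (hD : 0 < D)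
    (hfq : f q = 0) (hlq : l q = 0) (hfq' : f q' = D) (hlq' : l q' = 0) (ho : 0 < l o) :
    (∀ v, v ≠ q → v ≠ q' → 0 < l v) ∧ (∀ v, 0 < l v → f v / l v ≤ f o / l o) ∧
      ∀ v, 0 < l v → (D - f v) / l v ≤ (D - f o) / l o := by
  have hneg : IsDrawing G f (fun v => - l v) :=
    h.affine 1 0 0 0 (-1) 0 (by norm_num) (fun v => by ring) (fun v => by ring)
  have hrev : IsDrawing G (fun v => D - f v) l :=
    h.affine (-1) 0 D 0 1 0 (by norm_num) (fun v => by ring) (fun v => by ring)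
  have hl : ∀ v, 0 ≤ l v := by
    by_contra! hne
    obtain ⟨v, hv⟩ := hne
    obtain ⟨w, hw, h1, h2, -⟩ := hneg.exists_common_neighbor hD hfq (by simp [hlq]) hfq'
      (by simp [hlq']) ⟨v, by simpa using hv⟩
    rw [hG.unique w h1 h2] at hw
    linarith
  have hmax : ∀ v, 0 < l v → f v / l v ≤ f o / l o := by
    obtain ⟨w, hw, h1, h2, h3⟩ := h.exists_common_neighbor hD hfq hlq hfq' hlq' ⟨o, ho⟩
    rwa [hG.unique w h1 h2] at h3
  have hmax' : ∀ v, 0 < l v → (D - f v) / l v ≤ (D - f o) / l o := by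
    obtain ⟨w, hw, h1, h2, h3⟩ := hrev.exists_common_neighbor (q := q') (q' := q) hD
      (by simp [hfq']) hlq' (by simp [hfq]) hlq ⟨o, ho⟩
    rwa [hG.unique w h2 h1] at h3
  refine ⟨fun v hq hq' => (hl v).lt_of_ne' fun hv => ?_, hmax, hmax'⟩
  obtain ⟨r₁, r₂, h1, h2, h3, h4, h5⟩ := hG.left
  have hv0 := h.not_beyond hD hfq hlq hfq' hlq' ho hl hmax hmax' h1 hG.adj_left hG.adj h2 h3 h4
    h5 v hv
  obtain ⟨r₁, r₂, h1, h2, h3, h4, h5⟩ := hG.right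
  have hvD := hrev.not_beyond hD (q := q') (q' := q) (by simp [hfq']) hlq' (by simp [hfq]) hlq
    ho hl hmax' (by simpa using hmax) h1 hG.adj_right hG.adj.symm h2 h3 h4 h5 v hv
  rcases hv0.eq_or_lt with h0 | h0
  · exact hq (h.injective _ _ (by rw [hfq, ← h0]) (by rw [hlq, hv]))
  rcases hvD.eq_or_lt with h1 | h1
  · exact hq' (h.injective _ _ (by rw [hfq']; linarith) (by rw [hlq', hv]))
  refine ((h.adj_iff _ _).1 hG.adj).2 v ⟨f v / D, by positivity, ?_, ?_, ?_⟩
  · rw [div_lt_one hD]; linarith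
  · rw [hfq, hfq']; field_simp; ring
  · rw [hlq, hlq', hv]; ring

/-! ### Projecting the base line to infinity -/

theorem IsDrawing.adj_base_iff {V : Type*} {G : SimpleGraph V} {f l : V → ℝ}
    (h : IsDrawing G f l) {q : V} (hfq : f q = 0) (hlq : l q = 0) {v : V} (hv : 0 < l v) :
    G.Adj q v ↔ ∀ w, 0 < l w → f w / l w = f v / l v → l v ≤ l w := by
  rw [h.adj_iff]
  constructor
  · rintro ⟨-, hb⟩ w hw hwv
    by_contra! hlt
    rw [div_eq_div_iff hw.ne' hv.ne'] at hwv
    refine hb w ⟨l w / l v, by positivity, by rw [div_lt_one hv]; exact hlt, ?_, ?_⟩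
    · rw [hfq]; field_simp; linarith
    · rw [hlq]; field_simp; ring
  · refine fun hb => ⟨by rintro rfl; linarith, ?_⟩
    rintro z ⟨t, h0, h1, hx, hy⟩
    rw [hfq] at hx; rw [hlq] at hy
    have hlz : l z = t * l v := by rw [hy]; ring
    have hfz : f z = t * f v := by rw [hx]; ring
    have := hb z (by rw [hlz]; positivity) (by rw [hlz, hfz]; field_simp)
    rw [hlz] at this
    nlinarith

/-- The central projection that sends `(0, 0)` and `(D, 0)` to infinity preserves betweenness. -/
theorem blocks_projection_iff {V ι : Type*} {f l : V → ℝ} {D : ℝ} (hD : 0 < D) {e : ι → V}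
    {u w v : ι} (hu : 0 < l (e u)) (hw : 0 < l (e w)) (hv : 0 < l (e v)) :
    Blocks f l (e u) (e w) (e v) ↔
      Blocks (fun z => -f (e z) / l (e z)) (fun z => (f (e z) - D) / l (e z)) u w v := by
  constructor
  · rintro ⟨t, h0, h1, hx, hy⟩
    have h1t : 0 < 1 - t := by linarith
    -- A projection multiplies the weights of a convex combination by the heights and normalizes by
    -- the height of the middle point.
    refine ⟨t * l (e v) / l (e w), by positivity, ?_, ?_, ?_⟩
    · rw [div_lt_one hw, hy]
      have : 0 < (1 - t) * l (e u) := by positivity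
      nlinarith
    · field_simp
      rw [hx, hy]; ring
    · field_simp
      rw [hx, hy]; ring
  · rintro ⟨t, h0, h1, hx, hy⟩
    have h1t : 0 < 1 - t := by linarith
    simp only at hx hy
    field_simp at hx hy
    -- The projected coordinates add up to `-D / l`, so the sum of the two equations is a relation
    -- between the heights alone.
    have hs : l (e u) * l (e v) = l (e w) * ((1 - t) * l (e v) + t * l (e u)) := by
      have : D * (l (e u) * l (e v)) = D * (l (e w) * ((1 - t) * l (e v) + t * l (e u))) := by
        linarith
      exact mul_left_cancel₀ hD.ne' this
    refine ⟨t * l (e w) / l (e v), by positivity, ?_, ?_, ?_⟩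
    · rw [div_lt_one hv]
      have : 0 < l (e w) * ((1 - t) * l (e v)) := by positivity
      have : l (e u) * (t * l (e w)) < l (e u) * l (e v) := by linarith
      exact lt_of_mul_lt_mul_left this hu.le
    · field_simp
      have : l (e u) * (f (e w) * l (e v)) =
        l (e u) * (f (e u) * l (e v) + t * l (e w) * (f (e v) - f (e u))) := by
        linear_combination -hx - f (e u) * hs
      exact mul_left_cancel₀ hu.ne' this
    · field_simp
      have : l (e u) * (l (e w) * l (e v)) =
        l (e u) * (l (e u) * l (e v) + l (e w) * t * (l (e v) - l (e u))) := by
        linear_combination (- l (e u)) * hs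
      exact mul_left_cancel₀ (ne_of_gt hu) this

/-- The vertices `inl v` of `G` are points of the plane with coordinates `x` and `y`, and
the vertices `inr false` and `inr true` are the infinitely distant points below and to the left. -/
structure IsGridChart {ι : Type*} (G : SimpleGraph (ι ⊕ Bool)) (x y : ι → ℝ) : Prop where
  injective : ∀ u v, x u = x v → y u = y v → u = v
  adj_iff : ∀ u v, G.Adj (.inl u) (.inl v) ↔ u ≠ v ∧ ∀ w, ¬ Blocks x y u w v
  adj_vert : ∀ v, G.Adj (.inr false) (.inl v) ↔ ∀ w, x w = x v → y v ≤ y w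
  adj_horiz : ∀ v, G.Adj (.inr true) (.inl v) ↔ ∀ w, y w = y v → x v ≤ x w
  adj_infinity : G.Adj (.inr false) (.inr true)

theorem IsDrawing.isGridChart {ι : Type*} {G : SimpleGraph (ι ⊕ Bool)} {f l : ι ⊕ Bool → ℝ}
    (h : IsDrawing G f l) {D : ℝ} (hD : 0 < D) (hfq : f (.inr false) = 0)
    (hlq : l (.inr false) = 0) (hfq' : f (.inr true) = D) (hlq' : l (.inr true) = 0)
    (hl : ∀ v, 0 < l (.inl v)) :
    IsGridChart G (fun v => -f (.inl v) / l (.inl v)) (fun v => (f (.inl v) - D) / l (.inl v)) := by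
  have hrev : IsDrawing G (fun v => D - f v) l :=
    h.affine (-1) 0 D 0 1 0 (by norm_num) (fun v => by ring) (fun v => by ring)
  have hy (v w : ι) (hvw : f (.inl w) / l (.inl w) = f (.inl v) / l (.inl v)) :
      l (.inl v) ≤ l (.inl w) ↔
        (f (.inl v) - D) / l (.inl v) ≤ (f (.inl w) - D) / l (.inl w) := by
    rw [sub_div, sub_div, hvw, sub_le_sub_iff_left, div_le_div_iff_of_pos_left hD (hl w) (hl v)]
  refine ⟨fun u v hx hy => ?_, fun u v => ?_, fun v => ?_, fun v => ?_, ?_⟩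
  · have hu := hl u
    have hv := hl v
    field_simp at hx hy
    have hlv : l (.inl u) = l (.inl v) := by
      have : D * l (.inl u) = D * l (.inl v) := by linarith
      exact mul_left_cancel₀ hD.ne' this
    rw [hlv] at hx
    exact Sum.inl_injective (h.injective _ _ (mul_right_cancel₀ hv.ne' (by linarith)) hlv)
  · rw [h.adj_iff]
    refine and_congr (by simp) ⟨fun hb w hw => hb (.inl w) ?_, ?_⟩
    · exact (blocks_projection_iff hD (hl u) (hl w) (hl v)).2 hw
    · rintro hb (w | w) hw
      · exact hb w ((blocks_projection_iff hD (hl u) (hl w) (hl v)).1 hw)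
      · obtain ⟨t, h0, h1, -, hy⟩ := hw
        have hw0 : l (.inr w) = 0 := by cases w <;> assumption
        have h2 := hl u
        have h3 := hl v
        have h1t : 0 < 1 - t := by linarith
        have : 0 < (1 - t) * l (.inl u) + t * l (.inl v) := by positivity
        linarith
  · rw [h.adj_base_iff hfq hlq (hl v)]
    constructor
    · intro hb w hw
      have hw' : f (.inl w) / l (.inl w) = f (.inl v) / l (.inl v) := by
        rw [neg_div, neg_div] at hw; linarith
      exact (hy v w hw').1 (hb _ (hl w) hw')
    · rintro hb (w | w) hw hwv
      · exact (hy v w hwv).2 (hb w (by rw [neg_div, neg_div, hwv]))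
      · cases w <;> linarith
  · rw [hrev.adj_base_iff (q := .inr true) (by simp [hfq']) hlq' (hl v)]
    have hx (w : ι) (hvw : (D - f (.inl w)) / l (.inl w) = (D - f (.inl v)) / l (.inl v)) :
        l (.inl v) ≤ l (.inl w) ↔ -f (.inl v) / l (.inl v) ≤ -f (.inl w) / l (.inl w) := by
      rw [← div_le_div_iff_of_pos_left hD (hl w) (hl v)]
      rw [sub_div, sub_div] at hvw
      rw [neg_div, neg_div]
      constructor <;> intro <;> linarith
    have hsub (w : ι) : (f (.inl w) - D) / l (.inl w) = -((D - f (.inl w)) / l (.inl w)) := by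
      ring
    constructor
    · intro hb w hw
      have hw' : (D - f (.inl w)) / l (.inl w) = (D - f (.inl v)) / l (.inl v) := by
        rw [hsub, hsub] at hw; linarith
      exact (hx w hw').1 (hb _ (hl w) hw')
    · rintro hb (w | w) hw hwv
      · exact (hx w hwv).2 (hb w (by rw [hsub, hsub, hwv]))
      · cases w <;> linarith
  · refine (h.adj_iff _ _).2 ⟨by simp, ?_⟩
    rintro (w | _ | _) ⟨t, h0, h1, hx, hy⟩
    · have := hl w
      rw [hlq, hlq'] at hy
      linarith
    · rw [hfq, hfq'] at hx
      nlinarith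
    · rw [hfq, hfq'] at hx
      nlinarith

/-- Every grid realization of a graph with a corner has a chart whose coordinates are quotients of
integers that are quadratic in the coordinates of the realization. -/
theorem IsFanCorner.exists_isGridChart {ι : Type*} [Finite ι] {G : SimpleGraph (ι ⊕ Bool)} {o : ι}
    (hG : IsFanCorner G (.inr false) (.inr true) (.inl o)) {p : ι ⊕ Bool → ℤ × ℤ}
    (hp : IsGridRealization G p) {B : ℤ} (hB : ∀ v, |(p v).1| ≤ B ∧ |(p v).2| ≤ B) :
    ∃ (F L : ι → ℤ) (D : ℝ), (∀ v, 0 < L v) ∧ (∀ v, |F v| ≤ 8 * B ^ 2) ∧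
      (∀ v, L v ≤ 8 * B ^ 2) ∧
      IsGridChart G (fun v => -(F v : ℝ) / L v) (fun v => ((F v : ℝ) - D) / L v) ∧
      (∀ v, -(F o : ℝ) / L o ≤ -(F v : ℝ) / L v) ∧
      ∀ v, ((F o : ℝ) - D) / L o ≤ ((F v : ℝ) - D) / L v := by
  have hd := isRealization_iff_isDrawing.1 hp
  set q := p (.inr false) with hq
  set q' := p (.inr true) with hq'
  obtain ⟨a, ha⟩ : ∃ a, a = q'.1 - q.1 := ⟨_, rfl⟩
  obtain ⟨b, hb⟩ : ∃ b, b = q'.2 - q.2 := ⟨_, rfl⟩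
  have hab : (0 : ℝ) < (a : ℝ) ^ 2 + (b : ℝ) ^ 2 := by
    by_contra! hle
    have ha0 : (a : ℝ) = 0 := by nlinarith [sq_nonneg (a : ℝ), sq_nonneg (b : ℝ)]
    have hb0 : (b : ℝ) = 0 := by nlinarith [sq_nonneg (a : ℝ), sq_nonneg (b : ℝ)]
    have ha0' : a = 0 := by exact_mod_cast ha0
    have hb0' : b = 0 := by exact_mod_cast hb0
    have h1 : q.1 = q'.1 := by omega
    have h2 : q.2 = q'.2 := by omega
    have := hd.injective (.inr false) (.inr true) (by simp only [← hq, ← hq', h1])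
      (by simp only [← hq, ← hq', h2])
    simp at this
  -- Scalar and cross product with the vector from `q` to `q'`: a similarity with integer values
  -- that puts the base line on the horizontal axis, with `q'` at distance `D` from the origin.
  obtain ⟨f, hf⟩ : ∃ f : ι ⊕ Bool → ℤ, f = fun v =>
    a * ((p v).1 - q.1) + b * ((p v).2 - q.2) := ⟨_, rfl⟩
  obtain ⟨l, hl⟩ : ∃ l : ι ⊕ Bool → ℤ, l = fun v =>
    a * ((p v).2 - q.2) - b * ((p v).1 - q.1) := ⟨_, rfl⟩
  have hbound (r s u v : ℤ) (hr : |r| ≤ B) (hs : |s| ≤ B) (hu : |u| ≤ B) (hv : |v| ≤ B) :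
      |(r - s) * (u - v)| ≤ 4 * B ^ 2 := by
    have hB0 : 0 ≤ B := (abs_nonneg r).trans hr
    rw [abs_mul]
    have h1 : |r - s| ≤ 2 * B := (abs_sub _ _).trans (by linarith)
    have h2 : |u - v| ≤ 2 * B := (abs_sub _ _).trans (by linarith)
    calc |r - s| * |u - v| ≤ (2 * B) * (2 * B) := by gcongr
      _ = 4 * B ^ 2 := by ring
  have hfl (v : ι ⊕ Bool) : |f v| ≤ 8 * B ^ 2 ∧ |l v| ≤ 8 * B ^ 2 := by
    subst ha hb hf hl
    obtain ⟨h1, h2⟩ := hB v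
    obtain ⟨h3, h4⟩ := hB (.inr false)
    obtain ⟨h5, h6⟩ := hB (.inr true)
    constructor
    · refine (abs_add_le _ _).trans ?_
      linarith [hbound _ _ _ _ h5 h3 h1 h3, hbound _ _ _ _ h6 h4 h2 h4]
    · refine (abs_sub _ _).trans ?_
      linarith [hbound _ _ _ _ h5 h3 h2 h4, hbound _ _ _ _ h6 h4 h1 h3]
  set D : ℝ := (a : ℝ) ^ 2 + (b : ℝ) ^ 2 with hD
  have hsign (ε : ℝ) (hε : ε = 1 ∨ ε = -1) : IsDrawing G (fun v => (f v : ℝ))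
      (fun v => ε * (l v : ℝ)) := by
    refine hd.affine a b (-a * q.1 - b * q.2) (-ε * b) (ε * a) (ε * (b * q.1 - a * q.2)) ?_ ?_ ?_
    · rcases hε with rfl | rfl <;> nlinarith
    · intro v; simp only [hf]; push_cast; ring
    · intro v; simp only [hl]; push_cast; ring
  have hfq : (f (.inr false) : ℝ) = 0 := by simp [hf, ← hq]
  have hlq (ε : ℝ) : ε * (l (.inr false) : ℝ) = 0 := by simp [hl, ← hq]
  have hfq' : (f (.inr true) : ℝ) = D := by
    simp only [hf, ← hq', ← ha, ← hb, hD]; push_cast; ring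
  have hlq' (ε : ℝ) : ε * (l (.inr true) : ℝ) = 0 := by
    simp only [hl, ← hq', ← ha, ← hb]; push_cast; ring
  have hlo := hG.ne_zero (hsign 1 (Or.inl rfl)) hab hfq (hlq 1) hfq' (hlq' 1)
  -- Reflect, if necessary, to bring `o` above the base line.
  obtain ⟨ε, hε, hεl⟩ : ∃ ε : ℤ, (ε = 1 ∨ ε = -1) ∧ 0 < (ε : ℝ) * (l (.inl o) : ℝ) := by
    rcases lt_or_gt_of_ne hlo with h | h
    · exact ⟨-1, Or.inr rfl, by push_cast; linarith⟩
    · exact ⟨1, Or.inl rfl, by push_cast; linarith⟩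
  have hdr := hsign ε (by rcases hε with rfl | rfl <;> simp)
  obtain ⟨hpos, hmax, hmax'⟩ := hG.pos_and_max hdr hab hfq (hlq ε) hfq' (hlq' ε) hεl
  have hpos' (v : ι) : (0 : ℝ) < ε * (l (.inl v) : ℝ) := hpos _ (by simp) (by simp)
  have hchart := hdr.isGridChart hab hfq (hlq ε) hfq' (hlq' ε) hpos'
  refine ⟨fun v => f (.inl v), fun v => ε * l (.inl v), D, fun v => by exact_mod_cast hpos' v,
    fun v => (hfl _).1, fun v => ?_, ?_, fun v => ?_, fun v => ?_⟩
  · have := (hfl (.inl v)).2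
    refine (le_abs_self _).trans ?_
    rcases hε with rfl | rfl <;> simpa using this
  · simpa using hchart
  · have := hmax _ (hpos' v)
    push_cast
    rw [neg_div, neg_div]
    linarith
  · have := hmax' _ (hpos' v)
    push_cast
    rw [← neg_sub D, ← neg_sub D, neg_div, neg_div]
    linarith

/-! ### Recovering columns from the lowest points -/

theorem IsDrawing.swap {ι : Type*} {H : SimpleGraph ι} {x y : ι → ℝ} (h : IsDrawing H x y) :
    IsDrawing H y x :=
  h.affine 0 1 0 1 0 0 (by norm_num) (fun v => by ring) (fun v => by ring)

/-- `r` enumerates the lowest points of the vertical lines through the points. -/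
def IsBottom {ι : Type*} {m : ℕ} (x y : ι → ℝ) (r : Fin m → ι) : Prop :=
  ∀ v, (∀ w, x w = x v → y v ≤ y w) ↔ v ∈ Set.range r

section Columns

variable {ι : Type*} {H : SimpleGraph ι} {x y : ι → ℝ} {m : ℕ} {r s : Fin m → ι}

theorem IsBottom.le (hr : IsBottom x y r) {v : ι} {a : Fin m} (hv : x v = x (r a)) :
    y (r a) ≤ y v :=
  (hr (r a)).2 ⟨a, rfl⟩ v hv

theorem IsBottom.exists_eq [Finite ι] (hr : IsBottom x y r) (v : ι) : ∃ a, x v = x (r a) := by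
  obtain ⟨w, hw, hmin⟩ := Set.exists_min_image {w | x w = x v} y (Set.toFinite _) ⟨v, rfl⟩
  simp only [Set.mem_ofPred_eq] at hw hmin
  obtain ⟨a, rfl⟩ := (hr w).1 fun z hz => hmin z (hz.trans hw)
  exact ⟨a, hw.symm⟩

theorem IsBottom.injective (hr : IsBottom x y r) (h : IsDrawing H x y)
    (hri : Function.Injective r) : Function.Injective fun a => x (r a) := fun _ _ hab =>
  hri (h.injective _ _ hab (le_antisymm (hr.le hab.symm) (hr.le hab)))

/-- If the lowest points induce a path in the visibility graph, then it runs from left to right. -/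
theorem IsBottom.strictMono [Finite ι] (hr : IsBottom x y r) (h : IsDrawing H x y)
    (hri : Function.Injective r)
    (hpath : ∀ a b : Fin m, H.Adj (r a) (r b) → (a : ℕ) + 1 = b ∨ (b : ℕ) + 1 = a)
    (hmin : ∀ a : Fin m, (a : ℕ) = 0 → ∀ v, x (r a) ≤ x v) : StrictMono fun a => x (r a) := by
  have hinj := hr.injective h hri
  have key : ∀ n : ℕ, ∀ a : Fin m, (a : ℕ) = n → ∀ b, a < b → x (r a) < x (r b) := by
    intro n
    induction n using Nat.strong_induction_on with
    | _ n ih =>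
      intro a ha b hab
      rcases Nat.eq_zero_or_pos n with rfl | hn
      · exact lt_of_le_of_ne (hmin a ha _) fun he => hab.ne (hinj he)
      · have hlt := a.isLt
        obtain ⟨c, hc⟩ : ∃ c : Fin m, (c : ℕ) + 1 = n := ⟨⟨n - 1, by omega⟩, by simp; omega⟩
        -- By induction everything after `c` lies to its right. The nearest such column `d` has no
        -- column between it and `c`, so the two lowest points see each other, and the path
        -- condition makes `d` the successor of `c`.
        obtain ⟨d, hd, hdmin⟩ := Set.exists_min_image {d | c < d} (fun d => x (r d))
          (Set.toFinite _) ⟨a, by simp only [Set.mem_ofPred_eq, Fin.lt_def]; omega⟩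
        simp only [Set.mem_ofPred_eq] at hd hdmin
        have hcd : x (r c) < x (r d) := ih c (by omega) c rfl d hd
        have hadj : H.Adj (r c) (r d) := by
          refine (h.adj_iff _ _).2 ⟨fun he => hd.ne (hri he), ?_⟩
          rintro z ⟨t, h0, h1, hx, -⟩
          obtain ⟨e, he⟩ := hr.exists_eq z
          have h2 : x (r c) < x (r e) := by rw [← he, hx]; nlinarith
          have h3 : x (r e) < x (r d) := by rw [← he, hx]; nlinarith
          rcases lt_trichotomy e c with hec | rfl | hec
          · exact absurd (ih e (by rw [Fin.lt_def] at hec; omega) e rfl c hec) (by linarith)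
          · exact absurd h2 (lt_irrefl _)
          · exact absurd (hdmin e hec) (by linarith)
        have hda : d = a := by
          rw [Fin.lt_def] at hd
          rcases hpath _ _ hadj with h1 | h1
          · exact Fin.ext (by omega)
          · omega
        subst hda
        refine lt_of_le_of_ne (hdmin b (by rw [Fin.lt_def] at *; omega)) fun he => hab.ne (hinj he)
  exact fun a b hab => key a a rfl b hab

/-- Above the lowest point of a column, only the next point can see it. -/
theorem IsBottom.not_adj (hr : IsBottom x y r) (h : IsDrawing H x y) {u v : ι} {a : Fin m}
    (hu : x u = x (r a)) (hv : x v = x (r a)) (hur : u ≠ r a) (hvr : v ≠ r a) (huv : u ≠ v)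
    (hadj : H.Adj u (r a)) : ¬ H.Adj v (r a) := by
  intro hadj'
  have aux {u v : ι} (hu : x u = x (r a)) (hv : x v = x (r a)) (hur : u ≠ r a)
      (huv : y u < y v) (hadj : H.Adj v (r a)) : False := by
    have hlt : y (r a) < y u := lt_of_le_of_ne (hr.le hu) fun he =>
      hur (h.injective _ _ hu he.symm)
    have hpos : 0 < y v - y (r a) := by linarith
    refine ((h.adj_iff _ _).1 hadj).2 u ⟨(y v - y u) / (y v - y (r a)), div_pos (by linarith) hpos,
      by rw [div_lt_one hpos]; linarith, by rw [hu, hv]; ring, ?_⟩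
    field_simp; ring
  rcases lt_trichotomy (y u) (y v) with hlt | heq | hgt
  · exact aux hu hv hur hlt hadj'
  · exact huv (h.injective _ _ (hu.trans hv.symm) heq)
  · exact aux hv hu hvr hgt hadj

/-- If each point of the second row sees all lowest points, then a point of a higher row that sees
all lowest points but the `i`-th one lies above the `i`-th one. -/
theorem IsBottom.eq_of_adj [Finite ι] (hr : IsBottom x y r) (h : IsDrawing H x y)
    (hsi : Function.Injective s) (hrs : ∀ a b, s a ≠ r b)
    (hs : ∀ a b, H.Adj (s a) (r b)) {v : ι} (hvr : ∀ a, v ≠ r a) (hvs : ∀ a, v ≠ s a) {i : Fin m}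
    (hv : ∀ a, a ≠ i → H.Adj v (r a)) : x v = x (r i) := by
  choose c hc using hr.exists_eq
  have hinj : Function.Injective fun a => c (s a) := by
    intro a b hab
    by_contra hne
    have hca := hc (s a)
    have hcb := hc (s b)
    simp only at hab
    rw [← hab] at hcb
    exact hr.not_adj h hca hcb (hrs _ _) (hrs _ _) (fun he => hne (hsi he)) (hs _ _) (hs _ _)
  -- The points of the second row lie in different columns, one for each lowest point, so every
  -- column contains one. It is the one that sees the lowest point there, and `v` cannot.
  obtain ⟨b, hb⟩ := Finite.surjective_of_injective hinj (c v)
  simp only at hb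
  have hcb := hc (s b)
  rw [hb] at hcb
  have hnot := hr.not_adj h hcb (hc v) (hrs _ _) (hvr _) (hvs b).symm (hs _ _)
  by_contra hne
  refine hnot (hv _ fun hi => hne ?_)
  rw [← hi]; exact hc v

end Columns

theorem IsGridChart.isDrawing {ι : Type*} {G : SimpleGraph (ι ⊕ Bool)} {x y : ι → ℝ}
    (h : IsGridChart G x y) : IsDrawing (G.comap Sum.inl) x y :=
  ⟨h.injective, fun u v => h.adj_iff u v⟩

/-! ### The recursion for the ratios -/

/-- The recursion for the ratios of consecutive distances between the columns. -/
theorem ratio_recursion {g₀ g₁ g₂ g₃ h₀ h₁ h₂ t : ℝ} (hg₀ : 0 < g₀)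
    (hg₂ : 0 < g₂) (hh₀ : 0 < h₀) (hh₁ : 0 < h₁) (ht : 0 < t)
    (h1 : g₁ = t * g₀) (hanti : g₀ * h₁ = g₁ * h₂) (hanti' : g₁ * h₁ = g₂ * h₂)
    (hdiag : g₂ * h₁ = g₃ * h₀)
    (hlong : g₀ * h₁ = (g₁ + g₂) * h₀ ∨ (g₀ + g₁) * h₁ = g₂ * h₀)
    (hfree : g₀ * (h₁ + h₂) ≠ g₁ * h₀) : g₃ = (t + t ^ 2) * g₂ := by
  subst h1
  have e1 : h₁ = t * h₂ := by
    apply mul_left_cancel₀ hg₀.ne'; linarith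
  have hh₂ : 0 < h₂ := by
    by_contra! hle; nlinarith
  have e2 : g₂ = t ^ 2 * g₀ := by
    apply mul_right_cancel₀ hh₂.ne'; rw [e1] at hanti'; linarith
  subst e2
  rcases hlong with hl | hl
  · have e3 : h₁ = (t + t ^ 2) * h₀ := by
      apply mul_left_cancel₀ hg₀.ne'; linarith
    apply mul_right_cancel₀ hh₀.ne'; rw [← hdiag, e3]; ring
  · exfalso; apply hfree
    have e3 : (1 + t) * h₁ = t ^ 2 * h₀ := by
      apply mul_left_cancel₀ hg₀.ne'; linarith
    apply mul_left_cancel₀ ht.ne'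
    have : t * (h₁ + h₂) = t ^ 2 * h₀ := by rw [← e3, e1]; ring
    linear_combination g₀ * this

/-- The ratios of consecutive distances between the columns. -/
def ratio : ℕ → ℕ
  | 0 => 1
  | s + 1 => ratio s + ratio s ^ 2

theorem ratio_pos (s : ℕ) : 0 < ratio s := by
  induction s with
  | zero => simp [ratio]
  | succ s ih => simp only [ratio]; positivity

theorem ratio_lt (s : ℕ) : ratio s < 2 ^ 2 ^ s := by
  induction s with
  | zero => simp [ratio]
  | succ s ih =>
    simp only [ratio]
    rw [pow_succ 2 s, pow_mul]
    nlinarith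

theorem le_ratio (s : ℕ) : 2 ^ 2 ^ s ≤ ratio (s + 1) := by
  induction s with
  | zero => simp [ratio]
  | succ s ih =>
    rw [ratio, pow_succ 2 s, pow_mul]
    exact (Nat.pow_le_pow_left ih 2).trans (Nat.le_add_left _ _)

/-! ### Grid graphs and the grids they force -/

/-- The cells `(i, j)` of a grid with `m` columns and `R` rows, of which only the first `m'` rows
have full length and the other ones have two cells. -/
def cells (m m' R : ℕ) : Finset (ℕ × ℕ) :=
  (Finset.range m ×ˢ Finset.range m') ∪ (Finset.range 2 ×ˢ Finset.Ico m' R)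

theorem card_cells (m m' R : ℕ) : (cells m m' R).card = m * m' + 2 * (R - m') := by
  rw [cells, Finset.card_union_of_disjoint]
  · simp
  · rw [Finset.disjoint_left]
    intro a h1 h2
    simp only [Finset.mem_product, Finset.mem_range, Finset.mem_Ico] at h1 h2
    omega

theorem mem_cells {m m' R : ℕ} (hm : 2 ≤ m) (hR : m' ≤ R) {c : ℕ × ℕ} :
    c ∈ cells m m' R ↔ c.1 < m ∧ c.2 < R ∧ (c.2 < m' ∨ c.1 < 2) := by
  simp only [cells, Finset.mem_union, Finset.mem_product, Finset.mem_range, Finset.mem_Ico]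
  omega

/-- The adjacencies which force a double-exponential ratio of distances in every realization. -/
structure IsGridGraph (k m m' R : ℕ) (G : SimpleGraph (cells m m' R ⊕ Bool)) : Prop where
  adj_infinity : G.Adj (.inr false) (.inr true)
  adj_vert : ∀ v, G.Adj (.inr false) (.inl v) ↔ v.1.2 = 0
  adj_horiz : ∀ v, G.Adj (.inr true) (.inl v) ↔ v.1.1 = 0
  bottom_path : ∀ u v, u.1.2 = 0 → v.1.2 = 0 → G.Adj (.inl u) (.inl v) →
    u.1.1 + 1 = v.1.1 ∨ v.1.1 + 1 = u.1.1
  left_path : ∀ u v, u.1.1 = 0 → v.1.1 = 0 → G.Adj (.inl u) (.inl v) →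
    u.1.2 + 1 = v.1.2 ∨ v.1.2 + 1 = u.1.2
  bottom_adj : ∀ u v, u.1.2 = 0 → 1 ≤ v.1.2 → (v.1.1 ≠ u.1.1 ∨ v.1.2 = 1) →
    G.Adj (.inl v) (.inl u)
  left_adj : ∀ u v, u.1.1 = 0 → 1 ≤ v.1.1 → (v.1.2 ≠ u.1.2 ∨ v.1.1 = 1) →
    G.Adj (.inl v) (.inl u)
  -- `unit` and `anti` at 0 start the ratios at 1. The remaining missing edges are equations for the
  -- recursion, and the edge `free` excludes one of the two possible blockers of `long`.
  unit : ∀ u v, u.1 = (2, 3) → v.1 = (4, 5) → ¬ G.Adj (.inl u) (.inl v)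
  anti : ∀ s < k, ∀ u v, u.1 = (2 * s + 2, 2 * s + 5) → v.1 = (2 * s + 4, 2 * s + 3) →
    ¬ G.Adj (.inl u) (.inl v)
  anti' : ∀ s < k, ∀ u v, u.1 = (2 * s + 3, 2 * s + 5) → v.1 = (2 * s + 5, 2 * s + 3) →
    ¬ G.Adj (.inl u) (.inl v)
  diag : ∀ s < k, ∀ u v, u.1 = (2 * s + 4, 2 * s + 2) → v.1 = (2 * s + 6, 2 * s + 4) →
    ¬ G.Adj (.inl u) (.inl v)
  long : ∀ s < k, ∀ u v, u.1 = (2 * s + 2, 2 * s + 2) → v.1 = (2 * s + 5, 2 * s + 4) →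
    ¬ G.Adj (.inl u) (.inl v)
  free : ∀ s < k, ∀ u v, u.1 = (2 * s + 2, 2 * s + 2) → v.1 = (2 * s + 4, 2 * s + 5) →
    G.Adj (.inl u) (.inl v)

/-- The points of the cells lie on `m` vertical lines with abscissas `X` and on `R` horizontal
lines with ordinates `Y`, as the cells do, with a possible exception for the first two rows and
columns. -/
structure IsGridPlacement (m m' R : ℕ) (x y : cells m m' R → ℝ) (X Y : ℕ → ℝ) : Prop where
  lt_x : ∀ a b, a < b → b < m → X a < X b
  lt_y : ∀ a b, a < b → b < R → Y a < Y b
  exists_x : ∀ v, ∃ a < m, x v = X a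
  exists_y : ∀ v, ∃ b < R, y v = Y b
  eq_x : ∀ v, 2 ≤ v.1.1 → 2 ≤ v.1.2 → x v = X v.1.1
  eq_y : ∀ v, 2 ≤ v.1.1 → 2 ≤ v.1.2 → y v = Y v.1.2

/-- The neighbours of the lower infinite point are the bottom row and the other infinite point.
Along the bottom path the corner can see only (1, 0), and (2, 0) is the extra neighbour required;
the left side is symmetric. -/
theorem IsGridGraph.isFanCorner {k m m' R : ℕ} (hm : 3 ≤ m) (hm' : 3 ≤ m') (hR : m' ≤ R)
    {G : SimpleGraph (cells m m' R ⊕ Bool)} (hG : IsGridGraph k m m' R G) :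
    IsFanCorner G (.inr false) (.inr true)
      (.inl ⟨(0, 0), (mem_cells (by omega) hR).2 ⟨by omega, by omega, by omega⟩⟩) where
  adj := hG.adj_infinity
  adj_left := (hG.adj_vert _).2 rfl
  adj_right := (hG.adj_horiz _).2 rfl
  unique := by
    rintro (u | _ | _) h1 h2
    · rw [hG.adj_vert] at h1
      rw [hG.adj_horiz] at h2
      exact congrArg Sum.inl (Subtype.ext (Prod.ext h2 h1))
    · exact absurd rfl h1.ne
    · exact absurd rfl h2.ne
  left := by
    refine ⟨.inl ⟨(1, 0), (mem_cells (by omega) hR).2 ⟨by omega, by omega, by omega⟩⟩,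
      .inl ⟨(2, 0), (mem_cells (by omega) hR).2 ⟨by omega, by omega, by omega⟩⟩, ?_,
      (hG.adj_vert _).2 rfl, by simp, by simp, by simp⟩
    rintro (u | _ | _) h1 h2
    · rw [hG.adj_vert] at h1
      have := hG.bottom_path _ _ rfl h1 h2
      refine Or.inr (congrArg Sum.inl (Subtype.ext (Prod.ext ?_ h1)))
      simp only at this ⊢
      omega
    · exact absurd rfl h1.ne
    · exact Or.inl rfl
  right := by
    refine ⟨.inl ⟨(0, 1), (mem_cells (by omega) hR).2 ⟨by omega, by omega, by omega⟩⟩,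
      .inl ⟨(0, 2), (mem_cells (by omega) hR).2 ⟨by omega, by omega, by omega⟩⟩, ?_,
      (hG.adj_horiz _).2 rfl, by simp, by simp, by simp⟩
    rintro (u | _ | _) h1 h2
    · rw [hG.adj_horiz] at h1
      have := hG.left_path _ _ rfl h1 h2
      refine Or.inr (congrArg Sum.inl (Subtype.ext (Prod.ext h1 ?_)))
      simp only at this ⊢
      omega
    · exact Or.inl rfl
    · exact absurd rfl h1.ne

/-- In every chart of a grid graph the points lie on a grid. -/
theorem IsGridGraph.isGridPlacement {k m m' R : ℕ} (hm : 3 ≤ m) (hm' : 3 ≤ m') (hR : m' ≤ R)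
    {G : SimpleGraph (cells m m' R ⊕ Bool)} (hG : IsGridGraph k m m' R G)
    {x y : cells m m' R → ℝ} (h : IsGridChart G x y)
    (hx : ∀ u v, u.1 = (0, 0) → x u ≤ x v) (hy : ∀ u v, u.1 = (0, 0) → y u ≤ y v) :
    ∃ X Y, IsGridPlacement m m' R x y X Y ∧ ∀ a < m, ∃ v, X a = x v := by
  have hmem (c : ℕ × ℕ) (h1 : c.1 < m) (h2 : c.2 < R) (h3 : c.2 < m' ∨ c.1 < 2) :
      c ∈ cells m m' R := (mem_cells (by omega) hR).2 ⟨h1, h2, h3⟩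
  have hd := h.isDrawing
  let r : Fin m → cells m m' R := fun a =>
    ⟨(a, 0), hmem _ a.2 (show 0 < R by omega) (Or.inl (show 0 < m' by omega))⟩
  let r' : Fin m → cells m m' R := fun a =>
    ⟨(a, 1), hmem _ a.2 (show 1 < R by omega) (Or.inl (show 1 < m' by omega))⟩
  let c : Fin R → cells m m' R := fun b =>
    ⟨(0, b), hmem _ (show 0 < m by omega) b.2 (Or.inr (show 0 < 2 by omega))⟩
  let c' : Fin R → cells m m' R := fun b =>
    ⟨(1, b), hmem _ (show 1 < m by omega) b.2 (Or.inr (show 1 < 2 by omega))⟩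
  have hcell (v : cells m m' R) : v.1.1 < m ∧ v.1.2 < R :=
    ⟨((mem_cells (by omega) hR).1 v.2).1, ((mem_cells (by omega) hR).1 v.2).2.1⟩
  have hr : IsBottom x y r := by
    intro v
    rw [← h.adj_vert, hG.adj_vert]
    constructor
    · exact fun hv => ⟨⟨v.1.1, (hcell v).1⟩, Subtype.ext (Prod.ext rfl hv.symm)⟩
    · rintro ⟨a, rfl⟩; rfl
  have hc : IsBottom y x c := by
    intro v
    rw [← h.adj_horiz, hG.adj_horiz]
    constructor
    · exact fun hv => ⟨⟨v.1.2, (hcell v).2⟩, Subtype.ext (Prod.ext hv.symm rfl)⟩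
    · rintro ⟨a, rfl⟩; rfl
  have hri : Function.Injective r := fun a b hab => Fin.ext (congrArg (fun v => v.1.1) hab)
  have hri' : Function.Injective r' := fun a b hab => Fin.ext (congrArg (fun v => v.1.1) hab)
  have hci : Function.Injective c := fun a b hab => Fin.ext (congrArg (fun v => v.1.2) hab)
  have hci' : Function.Injective c' := fun a b hab => Fin.ext (congrArg (fun v => v.1.2) hab)
  have hrmono := hr.strictMono hd hri (fun a b hab => hG.bottom_path _ _ rfl rfl hab)
    (fun a ha v => hx _ v (Prod.ext ha rfl))
  have hcmono := hc.strictMono hd.swap hci (fun a b hab => hG.left_path _ _ rfl rfl hab)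
    (fun a ha v => hy _ v (Prod.ext rfl ha))
  refine ⟨fun a => if h : a < m then x (r ⟨a, h⟩) else 0,
    fun b => if h : b < R then y (c ⟨b, h⟩) else 0, ⟨?_, ?_, ?_, ?_, ?_, ?_⟩, ?_⟩
  · intro a b hab hb
    rw [dif_pos (hab.trans hb), dif_pos hb]
    exact hrmono (show (⟨a, _⟩ : Fin m) < ⟨b, _⟩ from hab)
  · intro a b hab hb
    rw [dif_pos (hab.trans hb), dif_pos hb]
    exact hcmono (show (⟨a, _⟩ : Fin R) < ⟨b, _⟩ from hab)
  · intro v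
    obtain ⟨a, ha⟩ := hr.exists_eq v
    exact ⟨a, a.2, by rw [dif_pos a.2]; exact ha⟩
  · intro v
    obtain ⟨a, ha⟩ := hc.exists_eq v
    exact ⟨a, a.2, by rw [dif_pos a.2]; exact ha⟩
  · intro v h1 h2
    rw [dif_pos (hcell v).1]
    refine hr.eq_of_adj (s := r') hd hri' ?_ ?_ ?_ ?_ ?_
    · exact fun a b hab => absurd (congrArg (fun v => v.1.2) hab) one_ne_zero
    · exact fun a b => hG.bottom_adj _ _ rfl le_rfl (Or.inr rfl)
    · rintro a rfl; exact absurd h2 (by simp [r])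
    · rintro a rfl; exact absurd h2 (by simp [r'])
    · exact fun a ha => hG.bottom_adj _ _ rfl (by omega)
        (Or.inl fun he => ha (Fin.ext he.symm))
  · intro v h1 h2
    rw [dif_pos (hcell v).2]
    refine hc.eq_of_adj (s := c') hd.swap hci' ?_ ?_ ?_ ?_ ?_
    · exact fun a b hab => absurd (congrArg (fun v => v.1.1) hab) one_ne_zero
    · exact fun a b => hG.left_adj _ _ rfl le_rfl (Or.inr rfl)
    · rintro a rfl; exact absurd h1 (by simp [c])
    · rintro a rfl; exact absurd h1 (by simp [c'])
    · exact fun a ha => hG.left_adj _ _ rfl (by omega)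
        (Or.inl fun he => ha (Fin.ext he.symm))
  · exact fun a ha => ⟨r ⟨a, ha⟩, dif_pos ha⟩

/-! ### Blockers as equations between gaps -/

section Placement

variable {m m' R : ℕ} {x y : cells m m' R → ℝ} {X Y : ℕ → ℝ}

theorem IsGridPlacement.lt_of_lt_x (hP : IsGridPlacement m m' R x y X Y) {a b : ℕ}
    (ha : a < m) (h : X a < X b) : a < b := by
  by_contra! hle
  rcases hle.eq_or_lt with rfl | hlt
  · exact lt_irrefl _ h
  · exact lt_asymm h (hP.lt_x _ _ hlt ha)

theorem IsGridPlacement.lt_of_lt_y (hP : IsGridPlacement m m' R x y X Y) {a b : ℕ}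
    (ha : a < R) (h : Y a < Y b) : a < b := by
  by_contra! hle
  rcases hle.eq_or_lt with rfl | hlt
  · exact lt_irrefl _ h
  · exact lt_asymm h (hP.lt_y _ _ hlt ha)

/-- Only the lines through the blocker matter, not which cell it is; so it may also be one of the
cells whose place is not determined. -/
theorem IsGridPlacement.exists_of_not_adj (hP : IsGridPlacement m m' R x y X Y)
    {H : SimpleGraph (cells m m' R)} (hd : IsDrawing H x y) {i i' j j' : ℕ} (hi : 2 ≤ i)
    (hii : i < i') (hi' : i' < m) (hj : 2 ≤ j) (hjj : j < j') (hjR : j' < R)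
    (hu : (i, j) ∈ cells m m' R) (hv : (i', j') ∈ cells m m' R)
    (hadj : ¬ H.Adj ⟨(i, j), hu⟩ ⟨(i', j'), hv⟩) :
    ∃ a b, i < a ∧ a < i' ∧ j < b ∧ b < j' ∧
      (X a - X i) * (Y j' - Y b) = (X i' - X a) * (Y b - Y j) := by
  rw [hd.adj_iff] at hadj
  push Not at hadj
  obtain ⟨w, t, h0, h1, hx, hy⟩ := hadj (by
    intro h; have := congrArg (fun v => v.1.1) h; simp only at this; omega)
  obtain ⟨a, ha, hxa⟩ := hP.exists_x w
  obtain ⟨b, hb, hyb⟩ := hP.exists_y w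
  rw [hxa, hP.eq_x _ hi hj, hP.eq_x _ (show 2 ≤ i' by omega) (show 2 ≤ j' by omega)] at hx
  rw [hyb, hP.eq_y _ hi hj, hP.eq_y _ (show 2 ≤ i' by omega) (show 2 ≤ j' by omega)] at hy
  simp only at hx hy
  have hX := hP.lt_x _ _ hii hi'
  have hY := hP.lt_y _ _ hjj hjR
  refine ⟨a, b, hP.lt_of_lt_x (by omega) ?_, hP.lt_of_lt_x ha ?_, hP.lt_of_lt_y (by omega) ?_,
    hP.lt_of_lt_y hb ?_, ?_⟩
  · nlinarith
  · nlinarith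
  · nlinarith
  · nlinarith
  · rw [hx, hy]; ring

theorem IsGridPlacement.exists_of_not_adj_anti (hP : IsGridPlacement m m' R x y X Y)
    {H : SimpleGraph (cells m m' R)} (hd : IsDrawing H x y) {i i' j j' : ℕ} (hi : 2 ≤ i)
    (hii : i < i') (hi' : i' < m) (hj : 2 ≤ j) (hjj : j < j') (hjR : j' < R)
    (hu : (i, j') ∈ cells m m' R) (hv : (i', j) ∈ cells m m' R)
    (hadj : ¬ H.Adj ⟨(i, j'), hu⟩ ⟨(i', j), hv⟩) :
    ∃ a b, i < a ∧ a < i' ∧ j < b ∧ b < j' ∧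
      (X a - X i) * (Y b - Y j) = (X i' - X a) * (Y j' - Y b) := by
  rw [hd.adj_iff] at hadj
  push Not at hadj
  obtain ⟨w, t, h0, h1, hx, hy⟩ := hadj (by
    intro h; have := congrArg (fun v => v.1.1) h; simp only at this; omega)
  obtain ⟨a, ha, hxa⟩ := hP.exists_x w
  obtain ⟨b, hb, hyb⟩ := hP.exists_y w
  rw [hxa, hP.eq_x _ hi (show 2 ≤ j' by omega), hP.eq_x _ (show 2 ≤ i' by omega) hj] at hx
  rw [hyb, hP.eq_y _ hi (show 2 ≤ j' by omega), hP.eq_y _ (show 2 ≤ i' by omega) hj] at hy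
  simp only at hx hy
  have hX := hP.lt_x _ _ hii hi'
  have hY := hP.lt_y _ _ hjj hjR
  refine ⟨a, b, hP.lt_of_lt_x (by omega) ?_, hP.lt_of_lt_x ha ?_, hP.lt_of_lt_y (by omega) ?_,
    hP.lt_of_lt_y hb ?_, ?_⟩
  · nlinarith
  · nlinarith
  · nlinarith
  · nlinarith
  · rw [hx, hy]; ring

/-- Here the place of the cell (a, b) must be known, since it is this cell that would block. -/
theorem IsGridPlacement.ne_of_adj (hP : IsGridPlacement m m' R x y X Y)
    {H : SimpleGraph (cells m m' R)} (hd : IsDrawing H x y) {i a i' j b j' : ℕ} (hi : 2 ≤ i)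
    (hia : i < a) (hai : a < i') (hi' : i' < m) (hj : 2 ≤ j) (hjb : j < b) (hbj : b < j')
    (hu : (i, j) ∈ cells m m' R) (hv : (i', j') ∈ cells m m' R)
    (hw : (a, b) ∈ cells m m' R) (hadj : H.Adj ⟨(i, j), hu⟩ ⟨(i', j'), hv⟩) :
    (X a - X i) * (Y j' - Y b) ≠ (X i' - X a) * (Y b - Y j) := by
  intro he
  have h1 := hP.lt_x _ _ hia (by omega)
  have h2 := hP.lt_x _ _ hai hi'
  have h3 : 0 < X i' - X i := by linarith
  refine ((hd.adj_iff _ _).1 hadj).2 ⟨(a, b), hw⟩ ⟨(X a - X i) / (X i' - X i),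
    div_pos (by linarith) h3, by rw [div_lt_one h3]; linarith, ?_, ?_⟩
  · rw [hP.eq_x ⟨(i, j), hu⟩ hi hj,
      hP.eq_x ⟨(i', j'), hv⟩ (show 2 ≤ i' by omega) (show 2 ≤ j' by omega),
      hP.eq_x ⟨(a, b), hw⟩ (show 2 ≤ a by omega) (show 2 ≤ b by omega)]
    field_simp; ring
  · rw [hP.eq_y ⟨(i, j), hu⟩ hi hj,
      hP.eq_y ⟨(i', j'), hv⟩ (show 2 ≤ i' by omega) (show 2 ≤ j' by omega),
      hP.eq_y ⟨(a, b), hw⟩ (show 2 ≤ a by omega) (show 2 ≤ b by omega)]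
    field_simp; linear_combination -he

end Placement

/-- In every chart of a grid graph the distances between the columns grow as the ratios do. -/
theorem IsGridGraph.ratio_eq {k m m' R : ℕ} (hk : 0 < k) (hm : 2 * k + 5 ≤ m)
    (hm' : 2 * k + 4 ≤ m') (hR : m' ≤ R) {G : SimpleGraph (cells m m' R ⊕ Bool)}
    (hG : IsGridGraph k m m' R G) {x y : cells m m' R → ℝ} (h : IsGridChart G x y) {X Y : ℕ → ℝ}
    (hP : IsGridPlacement m m' R x y X Y) {s : ℕ} (hs : s ≤ k) :
    X (2 * s + 4) - X (2 * s + 3) = ratio s * (X (2 * s + 3) - X (2 * s + 2)) := by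
  have hmem (a b : ℕ) (ha : a < m) (hb : b < m') : (a, b) ∈ cells m m' R :=
    (mem_cells (by omega) hR).2 ⟨ha, by simp only; omega, Or.inl hb⟩
  have hd := h.isDrawing
  induction s with
  | zero =>
    -- Both diagonals of this block of two by two gaps pass through its middle crossing, so its two
    -- column gaps are equal.
    obtain ⟨a, b, h1, h2, h3, h4, h5⟩ := hP.exists_of_not_adj hd (i := 2) (i' := 4) (j := 3)
      (j' := 5) (by omega) (by omega) (by omega) (by omega) (by omega) (by omega)
      (hmem _ _ (by omega) (by omega)) (hmem _ _ (by omega) (by omega)) (hG.unit _ _ rfl rfl)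
    obtain ⟨a', b', h1', h2', h3', h4', h5'⟩ := hP.exists_of_not_adj_anti hd (i := 2) (i' := 4)
      (j := 3) (j' := 5) (by omega) (by omega) (by omega) (by omega) (by omega) (by omega)
      (hmem _ _ (by omega) (by omega)) (hmem _ _ (by omega) (by omega)) (hG.anti 0 hk _ _ rfl rfl)
    obtain rfl : a = 3 := by omega
    obtain rfl : b = 4 := by omega
    obtain rfl : a' = 3 := by omega
    obtain rfl : b' = 4 := by omega
    have e1 := hP.lt_x 2 3 (by omega) (by omega)
    have e2 := hP.lt_x 3 4 (by omega) (by omega)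
    have e3 := hP.lt_y 3 4 (by omega) (by omega)
    have e4 := hP.lt_y 4 5 (by omega) (by omega)
    simp only [mul_zero, zero_add, ratio, Nat.cast_one, one_mul]
    have : (X 4 - X 3 - (X 3 - X 2)) * (Y 5 - Y 3) = 0 := by linear_combination -h5 - h5'
    rcases mul_eq_zero.1 this with h | h <;> linarith
  | succ s ih =>
    have ih := ih (by omega)
    have hsk : s < k := by omega
    have hpos := ratio_pos s
    obtain ⟨a, b, h1, h2, h3, h4, h5⟩ := hP.exists_of_not_adj_anti hd (i := 2 * s + 2)
      (i' := 2 * s + 4) (j := 2 * s + 3) (j' := 2 * s + 5) (by omega) (by omega) (by omega)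
      (by omega) (by omega) (by omega) (hmem _ _ (by omega) (by omega))
      (hmem _ _ (by omega) (by omega)) (hG.anti s hsk _ _ rfl rfl)
    obtain rfl : a = 2 * s + 3 := by omega
    obtain rfl : b = 2 * s + 4 := by omega
    obtain ⟨a, b, h1, h2, h3, h4, h6⟩ := hP.exists_of_not_adj_anti hd (i := 2 * s + 3)
      (i' := 2 * s + 5) (j := 2 * s + 3) (j' := 2 * s + 5) (by omega) (by omega) (by omega)
      (by omega) (by omega) (by omega) (hmem _ _ (by omega) (by omega))
      (hmem _ _ (by omega) (by omega)) (hG.anti' s hsk _ _ rfl rfl)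
    obtain rfl : a = 2 * s + 4 := by omega
    obtain rfl : b = 2 * s + 4 := by omega
    obtain ⟨a, b, h1, h2, h3, h4, h7⟩ := hP.exists_of_not_adj hd (i := 2 * s + 4)
      (i' := 2 * s + 6) (j := 2 * s + 2) (j' := 2 * s + 4) (by omega) (by omega) (by omega)
      (by omega) (by omega) (by omega) (hmem _ _ (by omega) (by omega))
      (hmem _ _ (by omega) (by omega)) (hG.diag s hsk _ _ rfl rfl)
    obtain rfl : a = 2 * s + 5 := by omega
    obtain rfl : b = 2 * s + 3 := by omega
    obtain ⟨a, b, h1, h2, h3, h4, h8⟩ := hP.exists_of_not_adj hd (i := 2 * s + 2)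
      (i' := 2 * s + 5) (j := 2 * s + 2) (j' := 2 * s + 4) (by omega) (by omega) (by omega)
      (by omega) (by omega) (by omega) (hmem _ _ (by omega) (by omega))
      (hmem _ _ (by omega) (by omega)) (hG.long s hsk _ _ rfl rfl)
    obtain rfl : b = 2 * s + 3 := by omega
    have h9 := hP.ne_of_adj hd (i := 2 * s + 2) (a := 2 * s + 3) (i' := 2 * s + 4)
      (j := 2 * s + 2) (b := 2 * s + 3) (j' := 2 * s + 5) (by omega) (by omega) (by omega)
      (by omega) (by omega) (by omega) (by omega) (hmem _ _ (by omega) (by omega))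
      (hmem _ _ (by omega) (by omega)) (hmem _ _ (by omega) (by omega))
      (hG.free s hsk _ _ rfl rfl)
    have e0 := hP.lt_x (2 * s + 2) (2 * s + 3) (by omega) (by omega)
    have e2 := hP.lt_x (2 * s + 4) (2 * s + 5) (by omega) (by omega)
    have f0 := hP.lt_y (2 * s + 2) (2 * s + 3) (by omega) (by omega)
    have f1 := hP.lt_y (2 * s + 3) (2 * s + 4) (by omega) (by omega)
    have := ratio_recursion (g₀ := X (2 * s + 3) - X (2 * s + 2))
      (g₁ := X (2 * s + 4) - X (2 * s + 3)) (g₂ := X (2 * s + 5) - X (2 * s + 4))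
      (g₃ := X (2 * s + 6) - X (2 * s + 5)) (h₀ := Y (2 * s + 3) - Y (2 * s + 2))
      (h₁ := Y (2 * s + 4) - Y (2 * s + 3)) (h₂ := Y (2 * s + 5) - Y (2 * s + 4))
      (t := ratio s) (by linarith) (by linarith) (by linarith) (by linarith)
      (by exact_mod_cast hpos) ih h5 h6 h7 ?_ ?_
    · simp only [ratio]
      push_cast
      exact this
    · have : a = 2 * s + 3 ∨ a = 2 * s + 4 := by omega
      rcases this with rfl | rfl
      · left; linear_combination h8
      · right; linear_combination h8
    · intro he
      exact h9 (by linear_combination he)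

/-- The grid realizations of a grid graph have coordinates of double-exponential size. -/
theorem IsGridGraph.ratio_le {k m m' R : ℕ} (hk : 0 < k) (hm : 2 * k + 5 ≤ m)
    (hm' : 2 * k + 4 ≤ m') (hR : m' ≤ R) {G : SimpleGraph (cells m m' R ⊕ Bool)}
    (hG : IsGridGraph k m m' R G) {p : cells m m' R ⊕ Bool → ℤ × ℤ} (hp : IsGridRealization G p)
    {B : ℤ} (hB : ∀ v, |(p v).1| ≤ B ∧ |(p v).2| ≤ B) : (ratio k : ℤ) ≤ 1024 * B ^ 6 := by
  obtain ⟨F, L, D, hL, hFB, hLB, hchart, hx, hy⟩ :=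
    (hG.isFanCorner (by omega) (by omega) hR).exists_isGridChart hp hB
  obtain ⟨X, Y, hP, hX⟩ := hG.isGridPlacement (by omega) (by omega) hR hchart
    (fun u v hu => by rw [show u = ⟨(0, 0), hu ▸ u.2⟩ from Subtype.ext hu]; exact hx v)
    (fun u v hu => by rw [show u = ⟨(0, 0), hu ▸ u.2⟩ from Subtype.ext hu]; exact hy v)
  have hr := hG.ratio_eq hk hm hm' hR hchart hP le_rfl
  have h1 := hP.lt_x (2 * k + 2) (2 * k + 3) (by omega) (by omega)
  obtain ⟨a, ha⟩ := hX (2 * k + 2) (by omega)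
  obtain ⟨b, hb⟩ := hX (2 * k + 3) (by omega)
  obtain ⟨c, hc⟩ := hX (2 * k + 4) (by omega)
  rw [ha, hb, hc] at hr
  rw [ha, hb] at h1
  have hLa := hL a
  have hLb := hL b
  have hLc := hL c
  have hLa' : (0 : ℝ) < L a := by exact_mod_cast hLa
  have hLb' : (0 : ℝ) < L b := by exact_mod_cast hLb
  have hLc' : (0 : ℝ) < L c := by exact_mod_cast hLc
  rw [div_lt_div_iff₀ hLa' hLb'] at h1
  field_simp at hr
  have h1' : 0 < F a * L b - F b * L a := by
    have : -F a * L b < -F b * L a := by exact_mod_cast h1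
    linarith
  have hr' : (F b * L c - F c * L b) * L a = ratio k * ((F a * L b - F b * L a) * L c) := by
    have : ((F b * L c - F c * L b) * L a : ℝ) = ratio k * ((F a * L b - F b * L a) * L c) := by
      linarith
    exact_mod_cast this
  have hB0 : 0 ≤ B := (abs_nonneg _).trans (hB (.inr false)).1
  -- After clearing denominators the ratio times a positive integer equals an integer polynomial in
  -- `F` and `L`, so it is bounded by the latter.
  calc (ratio k : ℤ) ≤ ratio k * ((F a * L b - F b * L a) * L c) :=
        le_mul_of_one_le_right (by positivity) (by
          have := mul_pos h1' hLc; omega)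
    _ = (F b * L c - F c * L b) * L a := hr'.symm
    _ ≤ (|F b| * L c + |F c| * L b) * L a := by
        have e1 : F b * L c ≤ |F b| * L c := by gcongr; exact le_abs_self _
        have e2 : -F c * L b ≤ |F c| * L b := by gcongr; exact neg_le_abs _
        gcongr
        linarith
    _ ≤ (8 * B ^ 2 * (8 * B ^ 2) + 8 * B ^ 2 * (8 * B ^ 2)) * (8 * B ^ 2) := by
        gcongr <;> first | exact hFB _ | exact hLB _
    _ = 1024 * B ^ 6 := by ring

/-! ### Coordinates that yield a grid graph -/

/-- Coordinates of the lines of a grid whose visibility graph is a grid graph. The first row and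
the first column are so far away that no three cells, one of which is there, are collinear unless
they are in the same row or column. -/
structure IsGridCoordinates (k m R : ℕ) (ξ η : ℕ → ℤ) (A B : ℤ) : Prop where
  strictMono_x : StrictMono ξ
  strictMono_y : StrictMono η
  le_x : ∀ i < m, ξ i - ξ 1 ≤ A
  le_y : ∀ j < R, η j - η 1 ≤ B
  far_y : A * B < η 1 - η 0
  far_x : A * (η 1 - η 0 + B) < ξ 1 - ξ 0
  ratio_x : ∀ s ≤ k, ξ (2 * s + 4) - ξ (2 * s + 3) = ratio s * (ξ (2 * s + 3) - ξ (2 * s + 2))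
  ratio_x' : ∀ s < k, ξ (2 * s + 5) - ξ (2 * s + 4) = ratio s * (ξ (2 * s + 4) - ξ (2 * s + 3))
  ratio_y : ∀ s < k,
    η (2 * s + 4) - η (2 * s + 3) = ratio (s + 1) * (η (2 * s + 3) - η (2 * s + 2))
  ratio_y' : ∀ s < k, η (2 * s + 4) - η (2 * s + 3) = ratio s * (η (2 * s + 5) - η (2 * s + 4))

section Coordinates

variable {ι : Type*} {x y : ι → ℤ}

theorem Blocks.mul_eq {u w v : ι} (h : Blocks (fun v => (x v : ℝ)) (fun v => (y v : ℝ)) u w v) :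
    (x w - x u) * (y v - y w) = (x v - x w) * (y w - y u) := by
  obtain ⟨t, -, -, hx, hy⟩ := h
  have : ((x w - x u) * (y v - y w) : ℝ) = (x v - x w) * (y w - y u) := by
    simp only at hx hy
    rw [hx, hy]; ring
  exact_mod_cast this

theorem Blocks.between_of_lt {u w v : ι}
    (h : Blocks (fun v => (x v : ℝ)) (fun v => (y v : ℝ)) u w v) (huv : x u < x v) :
    x u < x w ∧ x w < x v := by
  obtain ⟨t, h0, h1, hx, -⟩ := h
  simp only at hx
  have huv' : (x u : ℝ) < x v := by exact_mod_cast huv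
  have e1 : (x u : ℝ) < x w := by nlinarith
  have e2 : (x w : ℝ) < x v := by nlinarith
  exact ⟨by exact_mod_cast e1, by exact_mod_cast e2⟩

theorem Blocks.of_mul_eq {u w v : ι} (h1 : x u < x w) (h2 : x w < x v)
    (h : (x w - x u) * (y v - y w) = (x v - x w) * (y w - y u)) :
    Blocks (fun v => (x v : ℝ)) (fun v => (y v : ℝ)) u w v := by
  have h' : ((x w - x u) * (y v - y w) : ℝ) = (x v - x w) * (y w - y u) := by exact_mod_cast h
  have e1 : (x u : ℝ) < x w := by exact_mod_cast h1
  have e2 : (x w : ℝ) < x v := by exact_mod_cast h2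
  have e3 : (0 : ℝ) < x v - x u := by linarith
  refine ⟨(x w - x u) / (x v - x u), div_pos (by linarith) e3,
    by rw [div_lt_one e3]; linarith, ?_, ?_⟩
  · field_simp; ring
  · field_simp; linear_combination -h'

end Coordinates

/-- Collinearity equates two products of coordinate differences; one difference across the far gap
outweighs the whole other product. -/
theorem mul_ne_mul_of_large {p d q e A C : ℤ} (hp : A * C < p) (hd : 1 ≤ d) (hq₀ : 0 ≤ q)
    (hq : q ≤ A) (he₀ : 0 ≤ e) (he : e ≤ C) : p * d ≠ q * e := by
  have h1 : q * e ≤ A * C := mul_le_mul hq he he₀ (hq₀.trans hq)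
  have h2 : 0 ≤ q * e := mul_nonneg hq₀ he₀
  nlinarith

section GridCoordinates

variable {k m R : ℕ} {ξ η : ℕ → ℤ} {A B : ℤ}

/-- A cell of the first row and a cell outside of its row and column are not separated. -/
theorem IsGridCoordinates.bottom_ne (h : IsGridCoordinates k m R ξ η A B) {a i i' j j' : ℕ}
    (ha : a < m) (hi : i < m) (hj : j < R) (hj' : 0 < j') (hjj : j' < j)
    (hii : (a < i' ∧ i' < i) ∨ (i < i' ∧ i' < a)) :
    (ξ i' - ξ i) * (η 0 - η j') ≠ (ξ a - ξ i') * (η j' - η j) := by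
  have hx := h.strictMono_x
  have hy := h.strictMono_y
  have y1 : η 0 < η 1 := hy one_pos
  have y2 : η 1 ≤ η j' := hy.monotone hj'
  have y3 : η j' < η j := hy hjj
  have y4 := h.le_y j hj
  have hAB := h.far_y
  have hfar := h.far_x
  have hA : 0 ≤ A := by
    have := h.le_x 1 (by omega); linarith
  have hB : 0 ≤ B := by
    have := hy.monotone (show 1 ≤ j by omega); linarith
  rcases hii with ⟨h1, h2⟩ | ⟨h1, h2⟩
  · have x1 := hx h1
    have x2 := hx h2
    have x3 := h.le_x i hi
    have x4 : ξ 1 ≤ ξ i' := hx.monotone (by omega)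
    -- For the corner the horizontal distance `ξ i' - ξ 0` is not bounded by `A`, so the far first
    -- column has to decide instead of the far first row.
    rcases Nat.eq_zero_or_pos a with rfl | ha0
    · have := mul_ne_mul_of_large (p := ξ i' - ξ 0) (d := η j - η j') (q := ξ i - ξ i')
        (e := η j' - η 0) (A := A) (C := η 1 - η 0 + B) (by linarith) (by linarith) (by linarith)
        (by linarith) (by linarith) (by linarith)
      intro he; apply this; linarith
    · have x5 : ξ 1 ≤ ξ a := hx.monotone ha0
      have := mul_ne_mul_of_large (p := η j' - η 0) (d := ξ i - ξ i') (q := ξ i' - ξ a)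
        (e := η j - η j') (A := A) (C := B) (by linarith) (by linarith) (by linarith)
        (by linarith) (by linarith) (by linarith)
      intro he; apply this; linarith
  · have x1 := hx h1
    have x2 := hx h2
    have x3 := h.le_x a ha
    have x4 : ξ 1 ≤ ξ i' := hx.monotone (by omega)
    have := mul_ne_mul_of_large (p := η j' - η 0) (d := ξ i' - ξ i) (q := ξ a - ξ i')
      (e := η j - η j') (A := A) (C := B) (by linarith) (by linarith) (by linarith)
      (by linarith) (by linarith) (by linarith)
    intro he; apply this; linarith

/-- A cell of the first column and a cell outside of its row and column are not separated. -/
theorem IsGridCoordinates.left_ne (h : IsGridCoordinates k m R ξ η A B) {b i i' j j' : ℕ}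
    (hb : b < R) (hi : i < m) (hj : j < R) (hi' : 0 < i') (hii : i' < i)
    (hjj : (b < j' ∧ j' < j) ∨ (j < j' ∧ j' < b)) :
    (ξ i' - ξ i) * (η b - η j') ≠ (ξ 0 - ξ i') * (η j' - η j) := by
  have hx := h.strictMono_x
  have hy := h.strictMono_y
  have y1 := h.le_y j hj
  have y2 := h.le_y b hb
  have y3 : η 0 ≤ η b := hy.monotone (Nat.zero_le _)
  have y4 : η 0 ≤ η j := hy.monotone (Nat.zero_le _)
  have x1 : ξ 1 ≤ ξ i' := hx.monotone hi'
  have x2 := hx hii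
  have x3 := h.le_x i hi
  have hfar := h.far_x
  rcases hjj with ⟨h1, h2⟩ | ⟨h1, h2⟩
  · have y5 := hy h1
    have y6 := hy h2
    have := mul_ne_mul_of_large (p := ξ i' - ξ 0) (d := η j - η j') (q := ξ i - ξ i')
      (e := η j' - η b) (A := A) (C := η 1 - η 0 + B) (by linarith) (by linarith) (by linarith)
      (by linarith) (by linarith) (by linarith)
    intro he; apply this; linarith
  · have y5 := hy h1
    have y6 := hy h2
    have := mul_ne_mul_of_large (p := ξ i' - ξ 0) (d := η j' - η j) (q := ξ i - ξ i')
      (e := η b - η j') (A := A) (C := η 1 - η 0 + B) (by linarith) (by linarith) (by linarith)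
      (by linarith) (by linarith) (by linarith)
    intro he; apply this; linarith

/-- The missing edges hold because the prescribed ratios put an actual cell on each segment. The
edges hold by the distance of the first row and column, except for `free`, where the two candidate
rows are checked. -/
theorem IsGridCoordinates.isGridGraph {m' : ℕ} (h : IsGridCoordinates k m R ξ η A B)
    (hm : 2 * k + 5 ≤ m) (hm' : 2 * k + 4 ≤ m') (hk : 0 < k) (hR : m' ≤ R)
    {G : SimpleGraph (cells m m' R ⊕ Bool)}
    (hG : IsGridChart G (fun v => (ξ v.1.1 : ℝ)) (fun v => (η v.1.2 : ℝ))) :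
    IsGridGraph k m m' R G := by
  have hx := h.strictMono_x
  have hy := h.strictMono_y
  have hcell (v : cells m m' R) : v.1.1 < m ∧ v.1.2 < R ∧ (v.1.2 < m' ∨ v.1.1 < 2) :=
    (mem_cells (by omega) hR).1 v.2
  have hmem (a b : ℕ) (ha : a < m) (hb : b < R) (hab : b < m' ∨ a < 2) : (a, b) ∈ cells m m' R :=
    (mem_cells (by omega) hR).2 ⟨ha, hb, hab⟩
  have hblock (u v : cells m m' R) (a b : ℕ) (ha : a < m) (hb : b < R) (hab : b < m' ∨ a < 2)
      (h1 : u.1.1 < a) (h2 : a < v.1.1)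
      (he : (ξ a - ξ u.1.1) * (η v.1.2 - η b) = (ξ v.1.1 - ξ a) * (η b - η u.1.2)) :
      ¬ G.Adj (.inl u) (.inl v) := by
    rw [hG.adj_iff]
    intro hadj
    exact hadj.2 ⟨(a, b), hmem a b ha hb hab⟩
      (Blocks.of_mul_eq (x := fun v : cells m m' R => ξ v.1.1) (y := fun v => η v.1.2)
        (hx h1) (hx h2) he)
  have hblock' (u v : cells m m' R) (a b : ℕ) (ha : a < m) (hb : b < R) (hab : b < m' ∨ a < 2)
      (h1 : u.1.2 < b) (h2 : b < v.1.2)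
      (he : (η b - η u.1.2) * (ξ v.1.1 - ξ a) = (η v.1.2 - η b) * (ξ a - ξ u.1.1)) :
      ¬ G.Adj (.inl u) (.inl v) := by
    rw [hG.adj_iff]
    intro hadj
    exact hadj.2 ⟨(a, b), hmem a b ha hb hab⟩
      (Blocks.of_mul_eq (x := fun v : cells m m' R => η v.1.2) (y := fun v => ξ v.1.1)
        (hy h1) (hy h2) he).swap
  have hbx {u w v : cells m m' R}
      (hb : Blocks (fun v : cells m m' R => (ξ v.1.1 : ℝ)) (fun v => (η v.1.2 : ℝ)) u w v)
      (huv : u.1.1 < v.1.1) : u.1.1 < w.1.1 ∧ w.1.1 < v.1.1 := by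
    have := Blocks.between_of_lt (x := fun v : cells m m' R => ξ v.1.1) (y := fun v => η v.1.2)
      hb (hx huv)
    exact ⟨hx.lt_iff_lt.1 this.1, hx.lt_iff_lt.1 this.2⟩
  have hby {u w v : cells m m' R}
      (hb : Blocks (fun v : cells m m' R => (ξ v.1.1 : ℝ)) (fun v => (η v.1.2 : ℝ)) u w v)
      (huv : u.1.2 < v.1.2) : u.1.2 < w.1.2 ∧ w.1.2 < v.1.2 := by
    have := Blocks.between_of_lt (x := fun v : cells m m' R => η v.1.2) (y := fun v => ξ v.1.1)
      hb.swap (hy huv)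
    exact ⟨hy.lt_iff_lt.1 this.1, hy.lt_iff_lt.1 this.2⟩
  have heq {u w v : cells m m' R}
      (hb : Blocks (fun v : cells m m' R => (ξ v.1.1 : ℝ)) (fun v => (η v.1.2 : ℝ)) u w v) :=
    Blocks.mul_eq (x := fun v : cells m m' R => ξ v.1.1) (y := fun v => η v.1.2) hb
  refine ⟨hG.adj_infinity, fun v => ?_, fun v => ?_, fun u v hu hv hadj => ?_,
    fun u v hu hv hadj => ?_, fun u v hu hv hor => ?_, fun u v hu hv hor => ?_, ?_, ?_, ?_, ?_,
    ?_, ?_⟩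
  · rw [hG.adj_vert]
    constructor
    · intro hb
      have := hb ⟨(v.1.1, 0), hmem _ _ (hcell v).1 (by omega) (by omega)⟩ rfl
      simp only [Int.cast_le, hy.le_iff_le] at this
      omega
    · intro hv w _
      simp only [hv, Int.cast_le, hy.le_iff_le, Nat.zero_le]
  · rw [hG.adj_horiz]
    constructor
    · intro hb
      have := hb ⟨(0, v.1.2), hmem _ _ (by omega) (hcell v).2.1 (by omega)⟩ rfl
      simp only [Int.cast_le, hx.le_iff_le] at this
      omega
    · intro hv w _
      simp only [hv, Int.cast_le, hx.le_iff_le, Nat.zero_le]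
  · have aux (u v : cells m m' R) (hu : u.1.2 = 0) (hv : v.1.2 = 0)
        (hadj : G.Adj (.inl u) (.inl v)) (hlt : u.1.1 < v.1.1) : u.1.1 + 1 = v.1.1 := by
      by_contra hne
      refine hblock u v (u.1.1 + 1) 0 ?_ (by omega) (by omega) (by omega) (by omega) ?_ hadj
      · have := (hcell v).1; omega
      · rw [hu, hv]; ring
    rcases lt_trichotomy u.1.1 v.1.1 with hlt | he | hgt
    · exact Or.inl (aux u v hu hv hadj hlt)
    · exact absurd (congrArg Sum.inl (Subtype.ext (Prod.ext he (hu.trans hv.symm)))) hadj.ne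
    · exact Or.inr (aux v u hv hu hadj.symm hgt)
  · have aux (u v : cells m m' R) (hu : u.1.1 = 0) (hv : v.1.1 = 0)
        (hadj : G.Adj (.inl u) (.inl v)) (hlt : u.1.2 < v.1.2) : u.1.2 + 1 = v.1.2 := by
      by_contra hne
      refine hblock' u v 0 (u.1.2 + 1) (by omega) ?_ (by omega) (by omega) (by omega) ?_ hadj
      · have := (hcell v).2.1; omega
      · rw [hu, hv]; ring
    rcases lt_trichotomy u.1.2 v.1.2 with hlt | he | hgt
    · exact Or.inl (aux u v hu hv hadj hlt)
    · exact absurd (congrArg Sum.inl (Subtype.ext (Prod.ext (hu.trans hv.symm) he))) hadj.ne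
    · exact Or.inr (aux v u hv hu hadj.symm hgt)
  · rw [hG.adj_iff]
    refine ⟨fun he => by rw [he] at hv; omega, fun w hw => ?_⟩
    have h1 := hby hw.reverse (by omega)
    have h2 := heq hw
    rw [hu] at h2
    refine h.bottom_ne (hcell u).1 (hcell v).1 (hcell v).2.1 (by omega) h1.2 ?_ h2
    rcases lt_trichotomy v.1.1 u.1.1 with hlt | he | hgt
    · exact Or.inr (hbx hw hlt)
    · omega
    · exact Or.inl (hbx hw.reverse hgt)
  · rw [hG.adj_iff]
    refine ⟨fun he => by rw [he] at hv; omega, fun w hw => ?_⟩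
    have h1 := hbx hw.reverse (by omega)
    have h2 := heq hw
    rw [hu] at h2
    refine h.left_ne (hcell u).2.1 (hcell v).1 (hcell v).2.1 (by omega) h1.2 ?_ h2
    rcases lt_trichotomy v.1.2 u.1.2 with hlt | he | hgt
    · exact Or.inr (hby hw hlt)
    · omega
    · exact Or.inl (hby hw.reverse hgt)
  · intro u v hu hv
    have e1 := h.ratio_x 0 (by omega)
    have e2 := h.ratio_y' 0 (by omega)
    simp only [ratio] at e1 e2
    push_cast at e1 e2
    refine hblock u v 3 4 (by omega) (by omega) (by omega) (by simp [hu]) (by simp [hv]) ?_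
    rw [hu, hv]
    simp only
    linear_combination (η 3 - η 4) * e1 - (ξ 3 - ξ 2) * e2
  · intro s hs u v hu hv
    have e1 := h.ratio_x s (by omega)
    have e2 := h.ratio_y' s hs
    refine hblock u v (2 * s + 3) (2 * s + 4) (by omega) (by omega) (by omega) (by simp [hu])
      (by simp [hv]) ?_
    rw [hu, hv]
    simp only
    linear_combination (η (2 * s + 5) - η (2 * s + 4)) * e1 - (ξ (2 * s + 3) - ξ (2 * s + 2)) * e2
  · intro s hs u v hu hv
    have e1 := h.ratio_x' s hs
    have e2 := h.ratio_y' s hs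
    refine hblock u v (2 * s + 4) (2 * s + 4) (by omega) (by omega) (by omega) (by simp [hu])
      (by simp [hv]) ?_
    rw [hu, hv]
    simp only
    linear_combination (η (2 * s + 5) - η (2 * s + 4)) * e1 - (ξ (2 * s + 4) - ξ (2 * s + 3)) * e2
  · intro s hs u v hu hv
    have e1 := h.ratio_x (s + 1) (by omega)
    have e2 := h.ratio_y s hs
    rw [show 2 * (s + 1) + 4 = 2 * s + 6 by ring, show 2 * (s + 1) + 3 = 2 * s + 5 by ring,
      show 2 * (s + 1) + 2 = 2 * s + 4 by ring] at e1
    refine hblock u v (2 * s + 5) (2 * s + 3) (by omega) (by omega) (by omega) (by simp [hu])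
      (by simp [hv]) ?_
    rw [hu, hv]
    simp only
    linear_combination (ξ (2 * s + 5) - ξ (2 * s + 4)) * e2 - (η (2 * s + 3) - η (2 * s + 2)) * e1
  · intro s hs u v hu hv
    have e1 := h.ratio_x s (by omega)
    have e2 := h.ratio_x' s hs
    have e3 := h.ratio_y s hs
    refine hblock u v (2 * s + 3) (2 * s + 3) (by omega) (by omega) (by omega) (by simp [hu])
      (by simp [hv]) ?_
    rw [hu, hv]
    simp only [ratio] at e3 ⊢
    push_cast at e3
    have e4 : ξ (2 * s + 5) - ξ (2 * s + 3) =
        (ratio s + ratio s ^ 2) * (ξ (2 * s + 3) - ξ (2 * s + 2)) := by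
      linear_combination e2 + (1 + (ratio s : ℤ)) * e1
    rw [e3, e4]; ring
  · intro s hs u v hu hv
    rw [hG.adj_iff]
    refine ⟨fun he => by rw [he, hv] at hu; simp at hu, fun w hw => ?_⟩
    have h1 := hbx hw (by simp [hu, hv])
    have h2 := hby hw (by simp [hu, hv])
    have h3 := heq hw
    have e1 := h.ratio_x s (by omega)
    have e3 := h.ratio_y s hs
    have e4 := h.ratio_y' s hs
    simp only [ratio] at e3
    push_cast at e3
    have ht : (1 : ℤ) ≤ ratio s := by exact_mod_cast ratio_pos s
    have g0 : 0 < ξ (2 * s + 3) - ξ (2 * s + 2) := sub_pos.2 (hx (by omega))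
    have h0 : 0 < η (2 * s + 3) - η (2 * s + 2) := sub_pos.2 (hy (by omega))
    simp only [hu, hv] at h1 h2 h3
    have e5 : η (2 * s + 5) - η (2 * s + 4) =
        (1 + ratio s) * (η (2 * s + 3) - η (2 * s + 2)) := by
      apply mul_left_cancel₀ (show (ratio s : ℤ) ≠ 0 by omega)
      linear_combination e3 - e4
    obtain ⟨g, hg⟩ : ∃ g, g = ξ (2 * s + 3) - ξ (2 * s + 2) := ⟨_, rfl⟩
    obtain ⟨d, hd⟩ : ∃ d, d = η (2 * s + 3) - η (2 * s + 2) := ⟨_, rfl⟩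
    obtain ⟨t, htt⟩ : ∃ t : ℤ, t = ratio s := ⟨_, rfl⟩
    rw [← hg] at e1 g0
    rw [← hd] at e3 e5 h0
    rw [← htt] at e1 e3 e5 ht
    rw [show w.1.1 = 2 * s + 3 by omega, e1, ← hg] at h3
    have hw2 : w.1.2 = 2 * s + 3 ∨ w.1.2 = 2 * s + 4 := by omega
    have hgd : 0 < g * d := mul_pos g0 h0
    -- In units of `g` and `d` the column gaps are 1, t and the row gaps 1, t + t², 1 + t. A blocker
    -- would give 1 + t + t² = 0 or t³ + t² = 1, impossible for t ≥ 1.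
    rcases hw2 with hw2 | hw2
    · rw [hw2, ← hd, show η (2 * s + 5) - η (2 * s + 3) = (1 + 2 * t + t ^ 2) * d by
        linear_combination e3 + e5] at h3
      have : (1 + t + t ^ 2) * (g * d) = 0 := by linear_combination h3
      nlinarith [mul_pos (show 0 < 1 + t + t ^ 2 by nlinarith) hgd]
    · rw [hw2, e5, show η (2 * s + 4) - η (2 * s + 2) = (1 + t + t ^ 2) * d by
        linear_combination e3 - hd] at h3
      have : (t ^ 3 + t ^ 2 - 1) * (g * d) = 0 := by linear_combination -h3
      have h4 : 0 < t ^ 3 + t ^ 2 - 1 := by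
        have := one_le_pow₀ ht (n := 2)
        have := one_le_pow₀ ht (n := 3)
        linarith
      nlinarith [mul_pos h4 hgd]

end GridCoordinates

/-! ### Explicit gaps and their size -/

/-- The product of the squares of the first ratios. -/
def ratioProd : ℕ → ℕ
  | 0 => 1
  | s + 1 => ratioProd s * ratio s ^ 2

theorem ratioProd_pos (s : ℕ) : 0 < ratioProd s := by
  induction s with
  | zero => simp [ratioProd]
  | succ s ih => have := ratio_pos s; simp only [ratioProd]; positivity

theorem ratioProd_le (s : ℕ) : ratioProd s ≤ 2 ^ (2 * 2 ^ s) := by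
  induction s with
  | zero => simp [ratioProd]
  | succ s ih =>
    have := (ratio_lt s).le
    calc ratioProd s * ratio s ^ 2 ≤ 2 ^ (2 * 2 ^ s) * (2 ^ 2 ^ s) ^ 2 := by gcongr
      _ = 2 ^ (2 * 2 ^ (s + 1)) := by rw [← pow_mul, ← pow_add]; congr 1; ring

/-- The distances between consecutive columns, the first one of which is `M`. -/
def columnGap (M : ℕ) : ℕ → ℕ
  | 0 => M
  | 1 => 1
  | r + 2 => if r % 2 = 0 then ratioProd (r / 2) else ratioProd (r / 2) * ratio (r / 2)

/-- The distances between consecutive rows, the first one of which is `M`. -/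
def rowGap (k M : ℕ) : ℕ → ℕ
  | 0 => M
  | 1 => 1
  -- With t and t' the ratios of steps s and s + 1, the successive gaps t, t t', t' have the
  -- required quotients t' and t. Beyond the last step unit gaps suffice, so that extra rows stay
  -- cheap.
  | r + 2 => if r ≤ 2 * k then
      if r % 2 = 0 then ratio (r / 2) else ratio (r / 2) * ratio (r / 2 + 1)
    else 1

theorem columnGap_pos {M : ℕ} (hM : 0 < M) (r : ℕ) : 0 < columnGap M r := by
  match r with
  | 0 => exact hM
  | 1 => exact one_pos
  | r + 2 =>
    simp only [columnGap]
    split_ifs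
    · exact ratioProd_pos _
    · exact Nat.mul_pos (ratioProd_pos _) (ratio_pos _)

theorem rowGap_pos {k M : ℕ} (hM : 0 < M) (r : ℕ) : 0 < rowGap k M r := by
  match r with
  | 0 => exact hM
  | 1 => exact one_pos
  | r + 2 =>
    simp only [rowGap]
    split_ifs
    · exact ratio_pos _
    · exact Nat.mul_pos (ratio_pos _) (ratio_pos _)
    · exact one_pos

theorem columnGap_even (M s : ℕ) : columnGap M (2 * s + 2) = ratioProd s := by
  simp [columnGap]

theorem columnGap_odd (M s : ℕ) : columnGap M (2 * s + 3) = ratioProd s * ratio s := by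
  simp only [columnGap]
  rw [if_neg (by omega), show (2 * s + 1) / 2 = s by omega]

theorem rowGap_even {k s : ℕ} (M : ℕ) (hs : s ≤ k) : rowGap k M (2 * s + 2) = ratio s := by
  simp [rowGap, hs]

theorem rowGap_odd {k s : ℕ} (M : ℕ) (hs : s < k) :
    rowGap k M (2 * s + 3) = ratio s * ratio (s + 1) := by
  simp only [rowGap]
  rw [if_pos (by omega), if_neg (by omega), show (2 * s + 1) / 2 = s by omega]

theorem columnGap_le {k M r : ℕ} (hr : r + 1 < 2 * k + 5) :
    columnGap M (r + 1) ≤ 2 ^ (3 * 2 ^ (k + 1)) := by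
  match r with
  | 0 => exact Nat.one_le_two_pow
  | r + 1 =>
    have hle : ratioProd (r / 2) * ratio (r / 2) ≤ 2 ^ (3 * 2 ^ (k + 1)) :=
      calc ratioProd (r / 2) * ratio (r / 2) ≤ 2 ^ (2 * 2 ^ (r / 2)) * 2 ^ 2 ^ (r / 2) :=
            Nat.mul_le_mul (ratioProd_le _) (ratio_lt _).le
        _ = 2 ^ (3 * 2 ^ (r / 2)) := by rw [← pow_add]; congr 1; ring
        _ ≤ 2 ^ (3 * 2 ^ (k + 1)) := by gcongr <;> omega
    simp only [columnGap]
    split_ifs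
    · exact (Nat.le_mul_of_pos_right _ (ratio_pos _)).trans hle
    · exact hle

theorem rowGap_le (k M r : ℕ) : rowGap k M (r + 1) ≤ 2 ^ (3 * 2 ^ (k + 1)) := by
  match r with
  | 0 => exact Nat.one_le_two_pow
  | r + 1 =>
    simp only [rowGap]
    split_ifs with h1
    all_goals try exact Nat.one_le_two_pow
    all_goals
      have hle : ratio (r / 2) * ratio (r / 2 + 1) ≤ 2 ^ (3 * 2 ^ (k + 1)) :=
        calc ratio (r / 2) * ratio (r / 2 + 1) ≤ 2 ^ 2 ^ (r / 2) * 2 ^ 2 ^ (r / 2 + 1) :=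
              Nat.mul_le_mul (ratio_lt _).le (ratio_lt _).le
          _ = 2 ^ (3 * 2 ^ (r / 2)) := by rw [← pow_add]; congr 1; ring
          _ ≤ 2 ^ (3 * 2 ^ (k + 1)) := by gcongr <;> omega
    · exact (Nat.le_mul_of_pos_right _ (ratio_pos _)).trans hle
    · exact hle

theorem sum_range_gap_le {g : ℕ → ℕ} {E N i : ℕ} (hg : ∀ r, r + 1 < N → g (r + 1) ≤ E)
    (hi : i < N) : ∑ r ∈ Finset.range i, g r ≤ g 0 + N * E := by
  rcases i with _ | i
  · simp
  have key : ∀ j, j + 1 ≤ N → ∑ r ∈ Finset.range (j + 1), g r ≤ g 0 + j * E := by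
    intro j
    induction j with
    | zero => simp
    | succ j ih =>
      intro hj
      rw [Finset.sum_range_succ]
      have := ih (by omega)
      have := hg j (by omega)
      calc _ ≤ g 0 + j * E + E := by omega
        _ = g 0 + (j + 1) * E := by ring
  exact (key i (by omega)).trans (by gcongr; omega)

/-- A grid graph needs only coordinates of double-exponential size. -/
theorem exists_isGridCoordinates {k n R : ℕ} (hn : 2 * k + 5 ≤ n) (hR : R ≤ n) {W : ℤ}
    (hW : W = n * 2 ^ (3 * 2 ^ (k + 1))) :
    ∃ ξ η, IsGridCoordinates k (2 * k + 5) R ξ η W W ∧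
      ∀ i < 2 * k + 5, ∀ j < R, |ξ i| ≤ W ^ 4 ∧ ξ i + η j < 0 ∧ -(ξ i + η j) ≤ W ^ 4 := by
  obtain ⟨E, hE⟩ : ∃ E : ℕ, E = 2 ^ (3 * 2 ^ (k + 1)) := ⟨_, rfl⟩
  have hE0 : 0 < E := by rw [hE]; positivity
  obtain ⟨w, hw⟩ : ∃ w : ℕ, w = n * E := ⟨_, rfl⟩
  have hwW : W = w := by rw [hW, hw, hE]; push_cast; rfl
  have hw5 : 5 ≤ w := by rw [hw]; nlinarith
  subst hwW
  -- The least values allowed by `far_y` and `far_x` with both bounds equal to `w`.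
  obtain ⟨M, hM⟩ : ∃ M : ℕ, M = w * w + 1 := ⟨_, rfl⟩
  obtain ⟨M', hM'⟩ : ∃ M' : ℕ, M' = w * (M + w) + 1 := ⟨_, rfl⟩
  obtain ⟨x, hx⟩ : ∃ x : ℕ → ℕ, x = fun i => ∑ r ∈ Finset.range i, columnGap M' r := ⟨_, rfl⟩
  obtain ⟨y, hy⟩ : ∃ y : ℕ → ℕ, y = fun i => ∑ r ∈ Finset.range i, rowGap k M r := ⟨_, rfl⟩
  have hxs (i : ℕ) : x (i + 1) = x i + columnGap M' i := by simp [hx, Finset.sum_range_succ]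
  have hys (i : ℕ) : y (i + 1) = y i + rowGap k M i := by simp [hy, Finset.sum_range_succ]
  have hx0 : x 0 = 0 := by simp [hx]
  have hy0 : y 0 = 0 := by simp [hy]
  have hx1 : x 1 = M' := by simp [hx, columnGap]
  have hy1 : y 1 = M := by simp [hy, rowGap]
  have hxle (i : ℕ) (hi : i < 2 * k + 5) : x i ≤ M' + w := by
    have := sum_range_gap_le (g := columnGap M') (fun r hr => columnGap_le hr) hi
    rw [← hE] at this
    simp only [hx]
    refine this.trans (Nat.add_le_add le_rfl ?_)
    rw [hw]; gcongr
  have hyle (j : ℕ) (hj : j < R) : y j ≤ M + w := by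
    have := sum_range_gap_le (g := rowGap k M) (fun r _ => rowGap_le k M r) hj
    rw [← hE] at this
    simp only [hy]
    refine this.trans (Nat.add_le_add le_rfl ?_)
    rw [hw]; gcongr
  -- The shift that makes `ξ i + η j` negative, as it must be for images under the projection.
  obtain ⟨C, hC⟩ : ∃ C : ℕ, C = M' + M + 2 * w + 1 := ⟨_, rfl⟩
  have hCW : C ≤ w ^ 4 := by
    have : C = w ^ 3 + 2 * w ^ 2 + 3 * w + 3 := by rw [hC, hM', hM]; ring
    rw [this]
    nlinarith [pow_pos (show 0 < w by omega) 2, pow_pos (show 0 < w by omega) 3]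
  refine ⟨fun i => (x i : ℤ) - C, fun j => y j, ⟨?_, ?_, ?_, ?_, ?_, ?_, ?_, ?_, ?_, ?_⟩, ?_⟩
  · refine strictMono_nat_of_lt_succ fun i => ?_
    have := columnGap_pos (M := M') (by omega) i
    have := hxs i
    omega
  · refine strictMono_nat_of_lt_succ fun i => ?_
    have := rowGap_pos (k := k) (M := M) (by omega) i
    have := hys i
    omega
  · intro i hi
    have := hxle i hi
    omega
  · intro j hj
    have := hyle j hj
    omega
  · simp only [hy0, hy1, hM]; push_cast; linarith
  · simp only [hx0, hx1, hy0, hy1, hM']; push_cast; linarith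
  · intro s _
    have e1 := hxs (2 * s + 2)
    have e2 := hxs (2 * s + 3)
    rw [columnGap_even] at e1
    rw [columnGap_odd] at e2
    simp only [e2, e1]; push_cast; ring
  · intro s _
    have e1 := hxs (2 * s + 3)
    have e2 := hxs (2 * s + 4)
    rw [columnGap_odd] at e1
    rw [show 2 * s + 4 = 2 * (s + 1) + 2 by ring, columnGap_even] at e2
    simp only [show 2 * s + 5 = 2 * (s + 1) + 2 + 1 by ring, e2]
    simp only [show 2 * (s + 1) + 2 = 2 * s + 3 + 1 by ring, e1, ratioProd]; push_cast; ring
  · intro s hs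
    have e1 := hys (2 * s + 2)
    have e2 := hys (2 * s + 3)
    rw [rowGap_even M hs.le] at e1
    rw [rowGap_odd M hs] at e2
    simp only [e2, e1]; push_cast; ring
  · intro s hs
    have e1 := hys (2 * s + 3)
    have e2 := hys (2 * s + 4)
    rw [rowGap_odd M hs] at e1
    rw [show 2 * s + 4 = 2 * (s + 1) + 2 by ring, rowGap_even M hs] at e2
    simp only [show 2 * s + 5 = 2 * (s + 1) + 2 + 1 by ring, e2]
    simp only [show 2 * (s + 1) + 2 = 2 * s + 3 + 1 by ring, e1]; push_cast; ring
  · intro i hi j hj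
    have e1 := hxle i hi
    have e2 := hyle j hj
    have hCW' : (C : ℤ) ≤ (w : ℤ) ^ 4 := by exact_mod_cast hCW
    beta_reduce
    refine ⟨?_, ?_, ?_⟩
    · rw [abs_le]; constructor <;> omega
    · omega
    · omega

/-! ### Undoing the projection over the integers -/

/-- Integer points of the plane have, together with two infinitely distant points, a grid
realization in the sense of a central projection. -/
theorem exists_isGridRealization {ι : Type*} [Fintype ι] {x y : ι → ℤ} {S : ℤ} (hS : 1 ≤ S)
    (hinj : ∀ u v, x u = x v → y u = y v → u = v) (hx : ∀ v, |x v| ≤ S)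
    (hneg : ∀ v, x v + y v < 0) (hle : ∀ v, -(x v + y v) ≤ S) :
    ∃ (G : SimpleGraph (ι ⊕ Bool)) (p : ι ⊕ Bool → ℤ × ℤ), IsGridRealization G p ∧
      IsGridChart G (fun v => (x v : ℝ)) (fun v => (y v : ℝ)) ∧
      ∀ v, |(p v).1| ≤ S ^ (Fintype.card ι + 1) ∧ |(p v).2| ≤ S ^ (Fintype.card ι + 1) := by
  classical
  -- The projection gives `x + y = -D / l` and `x = -f / l`. With `D` the product `L` of all the
  -- numbers `-(x w + y w)`, the heights `P v` and the values `f = -x v * P v` are integers.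
  obtain ⟨P, hP⟩ : ∃ P : ι → ℤ, P = fun v => ∏ w ∈ Finset.univ.erase v, -(x w + y w) := ⟨_, rfl⟩
  obtain ⟨L, hL⟩ : ∃ L : ℤ, L = ∏ w, -(x w + y w) := ⟨_, rfl⟩
  have hPL (v : ι) : -(x v + y v) * P v = L := by
    rw [hP, hL]; exact Finset.mul_prod_erase _ (fun w => -(x w + y w)) (Finset.mem_univ v)
  have hL0 : 0 < L := by
    rw [hL]; exact Finset.prod_pos fun w _ => by have := hneg w; omega
  have hP0 (v : ι) : 0 < P v := by
    rw [hP]; exact Finset.prod_pos fun w _ => by have := hneg w; omega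
  have hLS : L ≤ S ^ Fintype.card ι := by
    rw [hL]
    exact (Finset.prod_le_prod (fun w _ => by have := hneg w; omega) fun w _ => hle w).trans_eq
      (by simp)
  have hPS (v : ι) : P v ≤ S ^ Fintype.card ι := by
    refine le_trans ?_ hLS
    rw [← hPL v]
    have := hneg v
    exact le_mul_of_one_le_left (hP0 v).le (by omega)
  obtain ⟨p, hp⟩ : ∃ p : ι ⊕ Bool → ℤ × ℤ, p = Sum.elim (fun v => (-x v * P v, P v))
    (fun b => (if b then L else 0, 0)) := ⟨_, rfl⟩
  have hpi : Function.Injective fun v => (((p v).1 : ℝ), ((p v).2 : ℝ)) := by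
    have : Function.Injective p := by
      rw [hp]
      rintro (u | u) (v | v) huv
      · simp only [Sum.elim_inl, Prod.mk.injEq] at huv
        obtain ⟨h1, h2⟩ := huv
        rw [h2] at h1
        have hxx : x u = x v := by
          have := mul_right_cancel₀ (hP0 v).ne' h1
          omega
        have h3 := hPL u
        rw [← hPL v, h2] at h3
        have := mul_right_cancel₀ (hP0 v).ne' h3
        exact congrArg _ (hinj u v hxx (by omega))
      · have := congrArg Prod.snd huv
        exact absurd this (hP0 u).ne'
      · have := congrArg Prod.snd huv
        exact absurd this.symm (hP0 v).ne'
      · cases u <;> cases v <;> simp [hL0.ne, hL0.ne'] at huv ⊢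
    intro u v huv
    apply this
    simp only [Prod.mk.injEq, Int.cast_inj] at huv
    exact Prod.ext huv.1 huv.2
  have hreal : IsGridRealization (visibilityGraph fun v => (((p v).1 : ℝ), ((p v).2 : ℝ))) p :=
    ⟨hpi, rfl⟩
  refine ⟨_, p, hreal, ?_, ?_⟩
  · have hchart := (isRealization_iff_isDrawing.1 hreal).isGridChart (D := L)
      (by exact_mod_cast hL0) (by simp [hp]) (by simp [hp]) (by simp [hp]) (by simp [hp])
      (fun v => by simpa [hp] using hP0 v)
    have hP0' (v : ι) : (P v : ℝ) ≠ 0 := by exact_mod_cast (hP0 v).ne'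
    convert hchart using 2 with v v
    · simp only [hp, Sum.elim_inl]
      have := hP0' v
      push_cast; field_simp
    · simp only [hp, Sum.elim_inl]
      have := hP0' v
      rw [← hPL v]
      push_cast; field_simp; ring
  · have hS' : S ^ Fintype.card ι ≤ S ^ (Fintype.card ι + 1) :=
      pow_le_pow_right₀ hS (Nat.le_succ _)
    have hS0 : (0 : ℤ) ≤ S ^ (Fintype.card ι + 1) := by positivity
    rw [hp]
    rintro (v | _ | _)
    · simp only [Sum.elim_inl, abs_mul, abs_neg, abs_of_pos (hP0 v)]
      refine ⟨?_, (hPS v).trans hS'⟩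
      rw [pow_succ']
      exact mul_le_mul (hx v) (hPS v) (hP0 v).le (by omega)
    · simpa using hS0
    · simp only [Sum.elim_inr, if_true, abs_of_pos hL0, abs_zero]
      exact ⟨hLS.trans hS', hS0⟩

/-! ### The graph on n vertices and the final estimates -/

theorem isRealization_comap_iff {V W : Type*} (e : V ≃ W) {G : SimpleGraph W} {p : W → ℝ × ℝ} :
    IsRealization (G.comap e) (p ∘ e) ↔ IsRealization G p := by
  have hvis : visibilityGraph (p ∘ e) = (visibilityGraph p).comap e := by
    ext u v
    simp [visibilityGraph, e.surjective.forall]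
  constructor
  · rintro ⟨h1, h2⟩
    refine ⟨fun u v huv => ?_, ?_⟩
    · have := @h1 (e.symm u) (e.symm v) (by simpa using huv)
      simpa using this
    · rw [hvis] at h2
      ext u v
      have := congrArg (fun H => H.Adj (e.symm u) (e.symm v)) h2
      simpa using this
  · rintro ⟨h1, rfl⟩
    exact ⟨h1.comp e.injective, hvis⟩

theorem isGridRealization_comap_iff {V W : Type*} (e : V ≃ W) {G : SimpleGraph W}
    {p : W → ℤ × ℤ} : IsGridRealization (G.comap e) (p ∘ e) ↔ IsGridRealization G p :=
  isRealization_comap_iff e (p := fun v => (((p v).1 : ℝ), ((p v).2 : ℝ)))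

/-- Padding rows have two cells: one lies on the left side and the other keeps the second column
complete for the pigeonhole argument. -/
theorem exists_graph_ratio_le {k n : ℕ} (hk : 0 < k) (hn : 2 + (2 * k + 5) * (2 * k + 6) ≤ n) :
    ∃ G : SimpleGraph (Fin n), IsPointVisibilityGraph G ∧
      (∀ q, IsGridRealization G q → ∀ B : ℤ, (∀ v, |(q v).1| ≤ B ∧ |(q v).2| ≤ B) →
        (ratio k : ℤ) ≤ 1024 * B ^ 6) ∧
      ∃ q, IsGridRealization G q ∧ ∀ v,
        |(q v).1| ≤ ((n * 2 ^ (3 * 2 ^ (k + 1)) : ℤ) ^ 4) ^ n ∧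
        |(q v).2| ≤ ((n * 2 ^ (3 * 2 ^ (k + 1)) : ℤ) ^ 4) ^ n := by
  -- Padding adds points in pairs. As the number of columns is odd, one of two consecutive values of
  -- `m'` gives the right parity.
  obtain ⟨m', h1, h2, heven⟩ : ∃ m', 2 * k + 5 ≤ m' ∧ m' ≤ 2 * k + 6 ∧
      (n - 2 - (2 * k + 5) * m') % 2 = 0 := by
    have h : (2 * k + 5) * (2 * k + 6) = (2 * k + 5) * (2 * k + 5) + (2 * k + 5) := by ring
    rcases Nat.mod_two_eq_zero_or_one (n - 2 - (2 * k + 5) * (2 * k + 5)) with h0 | h0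
    · exact ⟨2 * k + 5, le_rfl, by omega, h0⟩
    · exact ⟨2 * k + 6, by omega, le_rfl, by omega⟩
  have hmm : (2 * k + 5) * m' ≤ (2 * k + 5) * (2 * k + 6) := Nat.mul_le_mul_left _ h2
  have hmm' : m' ≤ (2 * k + 5) * m' := Nat.le_mul_of_pos_left _ (by omega)
  obtain ⟨R, hR⟩ : ∃ R, R = m' + (n - 2 - (2 * k + 5) * m') / 2 := ⟨_, rfl⟩
  have hcard : (cells (2 * k + 5) m' R).card = n - 2 := by
    rw [card_cells]; omega
  obtain ⟨W, hW⟩ : ∃ W : ℤ, W = n * 2 ^ (3 * 2 ^ (k + 1)) := ⟨_, rfl⟩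
  have hW1 : 1 ≤ W := by
    have : (1 : ℤ) ≤ n := by omega
    have : (1 : ℤ) ≤ 2 ^ (3 * 2 ^ (k + 1)) := one_le_pow₀ (by norm_num)
    rw [hW]; nlinarith
  obtain ⟨ξ, η, hco, hb⟩ := exists_isGridCoordinates (k := k) (n := n) (R := R) (by omega)
    (by omega) hW
  have hcell (v : cells (2 * k + 5) m' R) : v.1.1 < 2 * k + 5 ∧ v.1.2 < R :=
    have h := (mem_cells (m := 2 * k + 5) (by omega) (by omega)).1 v.2
    ⟨h.1, h.2.1⟩
  obtain ⟨G, p, hp, hchart, hpb⟩ := exists_isGridRealization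
    (x := fun v : cells (2 * k + 5) m' R => ξ v.1.1) (y := fun v => η v.1.2) (S := W ^ 4)
    (one_le_pow₀ hW1)
    (fun u v hx hy => Subtype.ext (Prod.ext (hco.strictMono_x.injective hx)
      (hco.strictMono_y.injective hy)))
    (fun v => (hb _ (hcell v).1 _ (hcell v).2).1) (fun v => (hb _ (hcell v).1 _ (hcell v).2).2.1)
    (fun v => (hb _ (hcell v).1 _ (hcell v).2).2.2)
  have hgrid := hco.isGridGraph (m' := m') le_rfl (by omega) hk (by omega) hchart
  let e : Fin n ≃ cells (2 * k + 5) m' R ⊕ Bool := Fintype.equivOfCardEq (by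
    rw [Fintype.card_fin, Fintype.card_sum, Fintype.card_coe, Fintype.card_bool, hcard]; omega)
  have hreal := (isGridRealization_comap_iff e).2 hp
  refine ⟨G.comap e, ⟨_, hreal⟩, fun q hq B hB => ?_, p ∘ e, hreal, fun v => ?_⟩
  · have hq' : IsGridRealization G (q ∘ e.symm) := by
      rw [← isGridRealization_comap_iff e]
      convert hq
      ext v <;> simp
    exact hgrid.ratio_le hk le_rfl (by omega) (by omega) hq' fun v => hB _
  · have hpow : (W ^ 4) ^ (Fintype.card (cells (2 * k + 5) m' R) + 1) ≤ (W ^ 4) ^ n :=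
      pow_le_pow_right₀ (one_le_pow₀ hW1) (by rw [Fintype.card_coe, hcard]; omega)
    rw [← hW]
    exact ⟨(hpb (e v)).1.trans hpow, (hpb (e v)).2.trans hpow⟩

/-- The n-th power multiplies the exponent, of order 2^k, by at most 2^(3k); it therefore only
changes the constant in front of k. -/
theorem coordinate_bound_le {k n : ℕ} (hk : 1 ≤ k) (hn : n ≤ (k + 1) ^ 3) :
    ((n * 2 ^ (3 * 2 ^ (k + 1))) ^ 4) ^ n ≤ 2 ^ 2 ^ (10 * k) := by
  have h1 : k + 1 ≤ 2 ^ k := Nat.lt_two_pow_self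
  have h2 : n ≤ 2 ^ (3 * k) := hn.trans (by
    rw [mul_comm 3 k, pow_mul]; exact Nat.pow_le_pow_left h1 3)
  calc ((n * 2 ^ (3 * 2 ^ (k + 1))) ^ 4) ^ n
      ≤ ((2 ^ (3 * k) * 2 ^ (3 * 2 ^ (k + 1))) ^ 4) ^ n := by gcongr
    _ ≤ ((2 ^ (3 * k) * 2 ^ (3 * 2 ^ (k + 1))) ^ 4) ^ 2 ^ (3 * k) :=
        Nat.pow_le_pow_right (by positivity) h2
    _ = 2 ^ ((3 * k + 6 * 2 ^ k) * 4 * 2 ^ (3 * k)) := by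
        rw [← pow_add, ← pow_mul, ← pow_mul]; congr 1; ring
    _ ≤ 2 ^ 2 ^ (10 * k) := by
        refine Nat.pow_le_pow_right (by norm_num) ?_
        calc (3 * k + 6 * 2 ^ k) * 4 * 2 ^ (3 * k) ≤ (2 ^ 4 * 2 ^ k) * 4 * 2 ^ (3 * k) := by
              gcongr; omega
          _ = 2 ^ (6 + 4 * k) := by rw [pow_add, show 4 * k = k + 3 * k by ring, pow_add]; ring
          _ ≤ 2 ^ (10 * k) := Nat.pow_le_pow_right (by norm_num) (by omega)

theorem mainTheorem3 :
    ∃ c C : ℝ, 0 < c ∧ 0 < C ∧ ∃ n₀ : ℕ, ∀ n : ℕ, n₀ ≤ n →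
      ∃ G : SimpleGraph (Fin n), IsPointVisibilityGraph G ∧
        (∀ q : Fin n → ℤ × ℤ, IsGridRealization G q →
          ∃ v : Fin n, (2 : ℝ) ^ ((2 : ℝ) ^ (c * (n : ℝ) ^ ((1 : ℝ) / 3))) ≤
            max |((q v).1 : ℝ)| |((q v).2 : ℝ)|) ∧
        (∃ q : Fin n → ℤ × ℤ, IsGridRealization G q ∧
          ∀ v : Fin n, max |((q v).1 : ℝ)| |((q v).2 : ℝ)| ≤
            (2 : ℝ) ^ ((2 : ℝ) ^ (C * (n : ℝ) ^ ((1 : ℝ) / 3)))) := by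
  -- From n = 1000 on, k = ⌊n^(1/3)⌋ is at least 10 and the (2k + 5)(2k + 6) + 2 vertices needed are
  -- at most k³. The factor 10 is that of `coordinate_bound_le`, and 1/4 leaves ample room to absorb
  -- 1024 B^6.
  refine ⟨1 / 4, 10, by norm_num, by norm_num, 1000, fun n hn => ?_⟩
  obtain ⟨κ, hκ⟩ : ∃ κ : ℝ, κ = (n : ℝ) ^ ((1 : ℝ) / 3) := ⟨_, rfl⟩
  have hκ0 : 0 ≤ κ := by rw [hκ]; positivity
  have hκ3 : κ ^ 3 = n := by
    rw [hκ, ← Real.rpow_natCast, ← Real.rpow_mul (by positivity)]; norm_num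
  have hκ10 : 10 ≤ κ := by
    by_contra! hlt
    have h1 : κ ^ 3 < 10 ^ 3 := pow_lt_pow_left₀ hlt hκ0 (by norm_num)
    have h2 : (1000 : ℝ) ≤ n := by exact_mod_cast hn
    rw [hκ3] at h1; linarith
  obtain ⟨k, hk⟩ : ∃ k, k = ⌊κ⌋₊ := ⟨_, rfl⟩
  have hk10 : 10 ≤ k := by rw [hk]; exact Nat.le_floor (by exact_mod_cast hκ10)
  have hkκ : (k : ℝ) ≤ κ := by rw [hk]; exact Nat.floor_le hκ0
  have hκk : κ < k + 1 := by rw [hk]; exact Nat.lt_floor_add_one κ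
  have hkn : k ^ 3 ≤ n := by
    have : (k : ℝ) ^ 3 ≤ n := by rw [← hκ3]; gcongr
    exact_mod_cast this
  have hnk : n ≤ (k + 1) ^ 3 := by
    have : (n : ℝ) ≤ ((k : ℝ) + 1) ^ 3 := by rw [← hκ3]; gcongr
    exact_mod_cast this
  obtain ⟨G, hG, hlow, q, hq, hup⟩ := exists_graph_ratio_le (k := k) (n := n) (by omega) (by
    refine le_trans ?_ hkn
    nlinarith [Nat.mul_le_mul hk10 (le_refl (k ^ 2)), Nat.mul_le_mul hk10 (le_refl k)])
  rw [← hκ]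
  refine ⟨G, hG, fun p hp => ?_, q, hq, fun v => ?_⟩
  · by_contra! hlt
    obtain ⟨z, hz⟩ : ∃ z : ℝ, z = (2 : ℝ) ^ (1 / 4 * κ) := ⟨_, rfl⟩
    rw [← hz] at hlt
    have hfloor (a : ℤ) (ha : |(a : ℝ)| < (2 : ℝ) ^ z) : |a| ≤ ⌊(2 : ℝ) ^ z⌋ :=
      Int.le_floor.2 (by push_cast; exact ha.le)
    have h1 := hlow p hp ⌊(2 : ℝ) ^ z⌋ fun v =>
      ⟨hfloor _ ((le_max_left _ _).trans_lt (hlt v)),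
        hfloor _ ((le_max_right _ _).trans_lt (hlt v))⟩
    -- With k = j + 6 the ratio is at least 2^2^(j + 5), whereas κ < j + 7 gives z ≤ 2^(j + 1) and
    -- hence the upper bound 2^(10 + 6 * 2^(j + 1)), which is smaller.
    obtain ⟨j, rfl⟩ : ∃ j, k = j + 6 := ⟨k - 6, by omega⟩
    have hzj : z ≤ 2 ^ (j + 1) := by
      rw [hz, ← Real.rpow_natCast]
      refine Real.rpow_le_rpow_of_exponent_le (by norm_num) ?_
      push_cast at hκk ⊢
      have : (4 : ℝ) ≤ j := by exact_mod_cast (show 4 ≤ j by omega)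
      linarith
    have h2 : ((2 : ℝ) ^ 2 ^ (j + 5)) ≤ ratio (j + 6) := by exact_mod_cast le_ratio (j + 5)
    have h3 : (ratio (j + 6) : ℝ) ≤ 1024 * (⌊(2 : ℝ) ^ z⌋ : ℝ) ^ 6 := by exact_mod_cast h1
    have h4 : (⌊(2 : ℝ) ^ z⌋ : ℝ) ≤ 2 ^ 2 ^ (j + 1) := by
      refine (Int.floor_le _).trans ?_
      rw [← Real.rpow_natCast 2 (2 ^ (j + 1))]
      refine Real.rpow_le_rpow_of_exponent_le (by norm_num) ?_
      push_cast; exact hzj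
    have h5 : (0 : ℝ) ≤ ⌊(2 : ℝ) ^ z⌋ := by
      exact_mod_cast Int.floor_nonneg.2 (by positivity)
    have h6 : (1024 * (⌊(2 : ℝ) ^ z⌋ : ℝ) ^ 6) ≤ 2 ^ (10 + 2 ^ (j + 1) * 6) := by
      rw [pow_add, pow_mul]
      calc (1024 * (⌊(2 : ℝ) ^ z⌋ : ℝ) ^ 6) ≤ 1024 * (2 ^ 2 ^ (j + 1)) ^ 6 := by gcongr
        _ = _ := by norm_num
    have h7 : 10 + 2 ^ (j + 1) * 6 < 2 ^ (j + 5) := by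
      have : 2 ^ 1 ≤ 2 ^ (j + 1) := Nat.pow_le_pow_right (by norm_num) (by omega)
      rw [show j + 5 = j + 1 + 4 by ring, pow_add _ (j + 1) 4]
      omega
    have h8 : (2 : ℝ) ^ (10 + 2 ^ (j + 1) * 6) < 2 ^ 2 ^ (j + 5) :=
      pow_lt_pow_right₀ (by norm_num) h7
    linarith
  · have hb : ((((n * 2 ^ (3 * 2 ^ (k + 1)) : ℤ) ^ 4) ^ n : ℤ) : ℝ) ≤
        (2 : ℝ) ^ ((2 : ℝ) ^ (10 * κ)) := by
      have h1 : ((((n * 2 ^ (3 * 2 ^ (k + 1)) : ℤ) ^ 4) ^ n : ℤ) : ℝ) ≤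
          (2 : ℝ) ^ (2 ^ (10 * k) : ℕ) := by
        exact_mod_cast coordinate_bound_le (k := k) (n := n) (by omega) hnk
      refine h1.trans ?_
      rw [← Real.rpow_natCast]
      refine Real.rpow_le_rpow_of_exponent_le (by norm_num) ?_
      push_cast
      rw [← Real.rpow_natCast]
      refine Real.rpow_le_rpow_of_exponent_le (by norm_num) ?_
      push_cast
      linarith
    refine (max_le ?_ ?_).trans hb
    · exact_mod_cast (hup v).1
    · exact_mod_cast (hup v).2
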